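/- Let $k$ be a field of characteristic zero, $S=k[x,y]$ with its usual grading $S=\bigoplus_p S_p$, $r\ge 0$, and let $\mathcal A$ be a central arrangement of $r+2$ lines in the plane, with coordinates chosen so that one of the lines is $x=0$. Let $Q=xF$ be a defining polynomial, so that $F\in S_{r+1}$ is a square-free product of $r+1$ linear forms that is not divisible by $x$. Let $A=\mathcal D(\mathcal A)$ be the subalgebra of $\operatorname{End}_k(S)$ generated by the multiplications by elements of $S$ and by the derivations $d$ of $S$ with $d(Q)\in QS$; we regard $S\subseteq A$ and put $E=x\partial_x+y\partial_y$, $D=F\partial_y$, elements of $A$. Grade $A$ by letting $A_n$ consist of the $t\in A$ with $t(S_p)\subseteq S_{p+n}$ for all $p$. Write $\operatorname{ad}(u)=[u,-]$; $u\in A$ is locally ad-nilpotent if every element of $A$ is killed by some power of $\operatorname{ad}(u)$, and then $\exp\operatorname{ad}(u)=\sum_{n\ge0}\frac1{n!}\operatorname{ad}(u)^n$. Let $\operatorname{Aut}_0(A)$ be the set of algebra automorphisms $\theta$ of $A$ for which there are $a,b,c,d,e,v\in k$ and $\phi_0\in S_r$ with $ad-bc\ne0$, $e\neq0$, $$\frac{1}{(ad-bc)e}\,Q(ax+by,cx+dy)=Q(x,y),$$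 $\theta(x)=ax+by$, $\theta(y)=cx+dy$, $\theta(E)=E+v$, and $\theta(D)=\phi_0-\frac{ebF}{ax+by}E+eD$ if $b\ne0$ (where $ax+by$ divides $F$), $\theta(D)=\phi_0+eD$ if $b=0$. Let $\operatorname{Exp}(A)$ be the set of automorphisms $\theta$ of $A$ for which there is $f\in S$ with $\theta(x)=x$, $\theta(y)=y$, $\theta(D)=D-F\,\partial_yf$, $\theta(E)=E-[E,f]$. Theorem. (1) Every choice of $a,b,c,d,e,v,\phi_0$ as above determines exactly one automorphism in $\operatorname{Aut}_0(A)$ of the displayed form. $\operatorname{Aut}_0(A)$ is a subgroup of $\operatorname{Aut}(A)$, and it is precisely the set of automorphisms that preserve the grading of $A$. If $\theta_0\in\operatorname{Aut}_0(A)$ then $\theta_0(S)=S$. (2) Every $f\in S$ is locally ad-nilpotent, and $\operatorname{Exp}(A)=\{\exp\operatorname{ad}(f):f\in S\}$ is the set of exponentials $\exp\operatorname{ad}(u)$ of all locally ad-nilpotent $u\in A$. It is a normal subgroup of $\operatorname{Aut}(A)$. (3) $\operatorname{Aut}(A)$ is the semidirect product $\operatorname{Aut}_0(A)\ltimes\operatorname{Exp}(A)$: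 every automorphism is $\theta_0\circ\eta$ for unique $\theta_0\in\operatorname{Aut}_0(A)$, $\eta\in\operatorname{Exp}(A)$, and $(\theta_0\eta_0)(\theta_1\eta_1)=(\theta_0\theta_1)\bigl((\theta_1\cdot\eta_0)\,\eta_1\bigr)$, for the right action of $\operatorname{Aut}_0(A)$ on $\operatorname{Exp}(A)$ by group automorphisms such that $$\theta_0\cdot\exp\operatorname{ad}(f)=\exp\operatorname{ad}(\theta_0^{-1}(f))\qquad(\theta_0\in\operatorname{Aut}_0(A),\ f\in S).$$ Equivalently, $\operatorname{Aut}(A)$ is isomorphic, through $(\eta,\theta_0)\mapsto\eta\circ\theta_0$, to the semidirect product $\operatorname{Exp}(A)\rtimes\operatorname{Aut}_0(A)$ for the left action $\eta\mapsto\theta_0^{-1}\cdot\eta$. -/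

import Mathlib

open MvPolynomial

noncomputable section

/-- A central arrangement of `r + 2` lines in the plane over `k`, in coordinates `x = X 0` and
`y = X 1` for which `x = 0` is one of the lines. It is recorded by the polynomial `F` for which
`x F` is a defining polynomial: `F` is a square-free product of `r + 1` linear forms, none of them
a multiple of `x`. -/
structure LineArrangement (k : Type*) [Field k] (r : ℕ) where
  F : MvPolynomial (Fin 2) k
  homogeneous : F.IsHomogeneous (r + 1)
  squarefree : Squarefree F
  not_dvd : ¬ (X 0 : MvPolynomial (Fin 2) k) ∣ F
  linear_factors : ∃ α : Fin (r + 1) → MvPolynomial (Fin 2) k,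
    (∀ i, (α i).IsHomogeneous 1) ∧ F = ∏ i, α i

namespace LineArrangement

variable {k : Type*} [Field k] {r : ℕ} (𝓐 : LineArrangement k r)

/-- The defining polynomial `Q = x F` of the arrangement. -/
def Q : MvPolynomial (Fin 2) k := X 0 * 𝓐.F

/-- The derivations of `S = k[x, y]` tangent to the arrangement: those with `d Q ∈ Q S`. -/
def tangentDerivations : Set (Derivation k (MvPolynomial (Fin 2) k) (MvPolynomial (Fin 2) k)) :=
  {d | 𝓐.Q ∣ d 𝓐.Q}

/-- The algebra of differential operators tangent to the arrangement: the subalgebra of `End_k(S)`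
generated by the multiplications by elements of `S` and by the tangent derivations. -/
def diffOps : Subalgebra k (Module.End k (MvPolynomial (Fin 2) k)) :=
  Algebra.adjoin k
    (Set.range (Algebra.lmul k (MvPolynomial (Fin 2) k)) ∪
      {T | ∃ d ∈ 𝓐.tangentDerivations, T = (d : Module.End k (MvPolynomial (Fin 2) k))})

/-- The algebra `diffOps` as a type. -/
def DiffAlg : Type _ := 𝓐.diffOps

instance : Ring 𝓐.DiffAlg := Subalgebra.toRing 𝓐.diffOps

instance : Algebra k 𝓐.DiffAlg := Subalgebra.algebra 𝓐.diffOps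

/-- The inclusion of the algebra of differential operators in `End_k(S)`. -/
def toEnd : 𝓐.DiffAlg →ₐ[k] Module.End k (MvPolynomial (Fin 2) k) := 𝓐.diffOps.val

/-- The inclusion of `S` in the algebra of differential operators, as multiplication operators. -/
def ofPoly : MvPolynomial (Fin 2) k →ₐ[k] 𝓐.DiffAlg :=
  (Algebra.lmul k (MvPolynomial (Fin 2) k)).codRestrict 𝓐.diffOps
    (fun f => Algebra.subset_adjoin (Or.inl ⟨f, rfl⟩))

/-- The derivation `x ∂/∂x + y ∂/∂y` of `S`. -/
def eulerDerivation (k : Type*) [Field k] :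
    Derivation k (MvPolynomial (Fin 2) k) (MvPolynomial (Fin 2) k) :=
  (X 0 : MvPolynomial (Fin 2) k) • pderiv 0 + (X 1 : MvPolynomial (Fin 2) k) • pderiv 1

/-- The derivation `F ∂/∂y` of `S`. -/
def verticalDerivation : Derivation k (MvPolynomial (Fin 2) k) (MvPolynomial (Fin 2) k) :=
  𝓐.F • pderiv 1

theorem eulerDerivation_mem : eulerDerivation k ∈ 𝓐.tangentDerivations := by
  have hQ : 𝓐.Q.IsHomogeneous (1 + (r + 1)) := (isHomogeneous_X k 0).mul 𝓐.homogeneous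
  have h := hQ.sum_X_mul_pderiv
  rw [Fin.sum_univ_two] at h
  refine ⟨((1 + (r + 1) : ℕ) : MvPolynomial (Fin 2) k), ?_⟩
  simpa [eulerDerivation, nsmul_eq_mul, mul_comm] using h

theorem verticalDerivation_mem : 𝓐.verticalDerivation ∈ 𝓐.tangentDerivations := by
  refine ⟨pderiv 1 𝓐.F, ?_⟩
  simp [verticalDerivation, Q, Derivation.leibniz, pderiv_X]
  ring

/-- The element `E = x ∂/∂x + y ∂/∂y` of the algebra of differential operators. -/
def E : 𝓐.DiffAlg :=
  ⟨(eulerDerivation k : Module.End k (MvPolynomial (Fin 2) k)),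
    Algebra.subset_adjoin (Or.inr ⟨_, 𝓐.eulerDerivation_mem, rfl⟩)⟩

/-- The element `D = F ∂/∂y` of the algebra of differential operators. -/
def D : 𝓐.DiffAlg :=
  ⟨(𝓐.verticalDerivation : Module.End k (MvPolynomial (Fin 2) k)),
    Algebra.subset_adjoin (Or.inr ⟨_, 𝓐.verticalDerivation_mem, rfl⟩)⟩

/-- The homogeneous component of degree `n` of the algebra of differential operators: the operators
that map `S_p` to `S_{p + n}` for all `p`. -/
def gradedPiece (n : ℕ) : Submodule k 𝓐.DiffAlg where
  carrier := {T | ∀ (p : ℕ) (f : MvPolynomial (Fin 2) k), f.IsHomogeneous p →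
    (𝓐.toEnd T f).IsHomogeneous (p + n)}
  zero_mem' := fun p _ _ => isHomogeneous_zero _ _ (p + n)
  add_mem' := fun hS hT p f hf => (hS p f hf).add (hT p f hf)
  smul_mem' := fun c _ hT p f hf =>
    (homogeneousSubmodule (Fin 2) k (p + n)).smul_mem c (hT p f hf)

/-- The condition `1 / ((a d - b c) e) • Q(a x + b y, c x + d y) = Q(x, y)`, with `(a, b; c, d)`
an invertible matrix and `e` a nonzero scalar. -/
def PreservesQ (a b c d e : k) : Prop :=
  a * d - b * c ≠ 0 ∧ e ≠ 0 ∧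
    C (((a * d - b * c) * e)⁻¹) *
      aeval ![C a * X 0 + C b * X 1, C c * X 0 + C d * X 1] 𝓐.Q = 𝓐.Q

/-- The automorphism `θ` is such that `θ(x) = a x + b y`, `θ(y) = c x + d y`, `θ(E) = E + v`, and
`θ(D)` is `φ₀ - (e b F / (a x + b y)) E + e D` if `b ≠ 0` and `φ₀ + e D` if `b = 0`. -/
structure IsStandard (a b c d e v : k) (φ₀ : MvPolynomial (Fin 2) k)
    (θ : 𝓐.DiffAlg ≃ₐ[k] 𝓐.DiffAlg) : Prop where
  map_x : θ (𝓐.ofPoly (X 0)) = 𝓐.ofPoly (C a * X 0 + C b * X 1)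
  map_y : θ (𝓐.ofPoly (X 1)) = 𝓐.ofPoly (C c * X 0 + C d * X 1)
  map_E : θ 𝓐.E = 𝓐.E + algebraMap k 𝓐.DiffAlg v
  map_D_of_ne : b ≠ 0 → ∃ G : MvPolynomial (Fin 2) k, (C a * X 0 + C b * X 1) * G = 𝓐.F ∧
    θ 𝓐.D = 𝓐.ofPoly φ₀ - 𝓐.ofPoly (C (e * b) * G) * 𝓐.E + e • 𝓐.D
  map_D_of_eq : b = 0 → θ 𝓐.D = 𝓐.ofPoly φ₀ + e • 𝓐.D

/-- The set `Aut₀` of explicit automorphisms given by a matrix preserving `Q` up to scalar, a shift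
of `E` by a scalar, and the addition of an element of `S_r` to `D`. -/
def aut₀ : Set (𝓐.DiffAlg ≃ₐ[k] 𝓐.DiffAlg) :=
  {θ | ∃ (a b c d e v : k) (φ₀ : MvPolynomial (Fin 2) k),
    𝓐.PreservesQ a b c d e ∧ φ₀.IsHomogeneous r ∧ 𝓐.IsStandard a b c d e v φ₀ θ}

/-- The inner derivation `ad(u) = [u, -]`. -/
def ad (u : 𝓐.DiffAlg) : Module.End k 𝓐.DiffAlg where
  toFun t := u * t - t * u
  map_add' s t := by rw [mul_add, add_mul, add_sub_add_comm]
  map_smul' c t := by rw [RingHom.id_apply, mul_smul_comm, smul_mul_assoc, smul_sub]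

/-- The set `Exp` of automorphisms for which there is `f ∈ S` such that `x ↦ x`, `y ↦ y`,
`D ↦ D - F f_y` and `E ↦ E - [E, f]`. -/
def expAut : Set (𝓐.DiffAlg ≃ₐ[k] 𝓐.DiffAlg) :=
  {θ | ∃ f : MvPolynomial (Fin 2) k,
    θ (𝓐.ofPoly (X 0)) = 𝓐.ofPoly (X 0) ∧
    θ (𝓐.ofPoly (X 1)) = 𝓐.ofPoly (X 1) ∧
    θ 𝓐.D = 𝓐.D - 𝓐.ofPoly (𝓐.F * pderiv 1 f) ∧
    θ 𝓐.E = 𝓐.E - 𝓐.ad 𝓐.E (𝓐.ofPoly f)}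

/-- An element `u` is locally ad-nilpotent if every element is killed by a power of `ad u`. -/
def IsLocallyAdNilpotent (u : 𝓐.DiffAlg) : Prop :=
  ∀ t : 𝓐.DiffAlg, ∃ n : ℕ, (𝓐.ad u ^ n) t = 0

/-- The exponential `exp ad(u) = ∑ ad(u)^n / n!` of a locally ad-nilpotent element `u`; the sum has
finitely many nonzero terms at each element. -/
def expAd (u : 𝓐.DiffAlg) : 𝓐.DiffAlg → 𝓐.DiffAlg :=
  fun t => ∑ᶠ n : ℕ, ((n.factorial : k)⁻¹) • (𝓐.ad u ^ n) t

end LineArrangement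

end

/-! The tangent derivations form a free $S$-module on $E$ and $D$, so $A$ is generated by $S$, $E$,
$D$ with $[E,s]=E(s)$, $[D,s]=D(s)$, $[E,D]=rD$. The ordered monomials $D^iE^j$ are independent over
$S$, and $A$ is a domain: both follow by applying $\operatorname{ad}(x)$ and $\operatorname{ad}(y)$,
which are locally nilpotent, until only polynomials are left.

The key point is that the lines of the arrangement can be read off from the ring $A$. An irreducible
$p\in S$ satisfies $Ap\subseteq pA$ exactly when $p\mid Q$. If $u$ is locally ad-nilpotent and $p$
is such an element, then $[u,p]\in pA$, and in a domain of characteristic zero this forces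
$[u,p]=0$. As $Q$ has two independent linear factors, $u$ commutes with $S$ and hence lies in $S$
(`exists_eq_ofPoly_of_isLocallyAdNilpotent`).

Every automorphism $\theta$ therefore restricts to an automorphism $\sigma$ of $S$ that permutes the
lines, so that $\sigma$ is linear and preserves $Q$ up to a scalar (`exists_preservesQ`).
Conversely, conjugation by such a $\sigma$ in $\operatorname{End}_k(S)$ preserves $A$
(`exists_conj`). Dividing $\theta$ by this conjugation leaves an automorphism that fixes $S$; it is
given by $E\mapsto E+\varepsilon$, $D\mapsto D+\varphi$ with $E(\varphi)=D(\varepsilon)+r\varphi$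
(`exists_eq_of_fix`, `exists_shift`). Writing $\varepsilon=v-E(f)$ with $v\in k$, the factor
$\exp\operatorname{ad}(f)$ accounts for $-E(f)$, and what remains moves $E$ by a constant. This last
condition characterizes $\operatorname{Aut}_0(A)$, since the grading is the eigenspace decomposition
of $\operatorname{ad}(E)$. -/

noncomputable section

local notation "𝕊" => MvPolynomial (Fin 2)

/-! ### Polynomials in two variables: the Euler derivation, divisibility, linear substitutions. -/

namespace PlanePoly

variable {k : Type*} [Field k]

theorem eulerDerivation_apply (f : 𝕊 k) :
    LineArrangement.eulerDerivation k f = X 0 * pderiv 0 f + X 1 * pderiv 1 f := rfl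

theorem derivation_ext {d₁ d₂ : Derivation k (𝕊 k) (𝕊 k)} (h₀ : d₁ (X 0) = d₂ (X 0))
    (h₁ : d₁ (X 1) = d₂ (X 1)) : d₁ = d₂ :=
  MvPolynomial.derivation_ext fun i => by fin_cases i <;> assumption

theorem euler_of_isHomogeneous {n : ℕ} {f : 𝕊 k} (hf : f.IsHomogeneous n) :
    LineArrangement.eulerDerivation k f = (n : 𝕊 k) * f := by
  have h := hf.sum_X_mul_pderiv
  rwa [Fin.sum_univ_two, nsmul_eq_mul] at h

theorem homogeneousComponent_euler (n : ℕ) (f : 𝕊 k) :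
    homogeneousComponent n (LineArrangement.eulerDerivation k f) =
      (n : 𝕊 k) * homogeneousComponent n f := by
  have key : ∀ m : ℕ, homogeneousComponent n
      (LineArrangement.eulerDerivation k (homogeneousComponent m f)) =
        (n : 𝕊 k) * homogeneousComponent n (homogeneousComponent m f) := by
    intro m
    have hm := homogeneousComponent_isHomogeneous m f
    have hm' : ((m : 𝕊 k) * homogeneousComponent m f).IsHomogeneous m := by
      simpa using hm.C_mul (m : k)
    rw [euler_of_isHomogeneous hm, homogeneousComponent_of_mem hm',
      homogeneousComponent_of_mem hm]
    split_ifs with h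
    · rw [h]
    · rw [mul_zero]
  conv_lhs => rw [← sum_homogeneousComponent f]
  conv_rhs => rw [← sum_homogeneousComponent f]
  simp only [map_sum, key, Finset.mul_sum]

/-- In characteristic zero the Euler derivation has distinct eigenvalues on components of distinct
degrees. -/
theorem isHomogeneous_of_euler [CharZero k] {n : ℕ} {f : 𝕊 k}
    (hf : LineArrangement.eulerDerivation k f = (n : 𝕊 k) * f) : f.IsHomogeneous n := by
  have h0 : ∀ m, m ≠ n → homogeneousComponent m f = 0 := by
    intro m hm
    have h := homogeneousComponent_euler m f
    have hC : (n : 𝕊 k) = C (n : k) := by simp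
    rw [hf, hC, homogeneousComponent_C_mul, ← hC, ← sub_eq_zero, ← sub_mul] at h
    rcases mul_eq_zero.1 h with h | h
    · exact absurd (Nat.cast_injective (sub_eq_zero.1 h)).symm hm
    · exact h
  intro d hd
  by_contra hne
  have h := congrArg (coeff d) (h0 d.degree (by rwa [Finsupp.degree_eq_weight_one]))
  rw [coeff_homogeneousComponent, if_pos rfl, coeff_zero] at h
  exact hd h

/-- Every polynomial is the sum of its constant term and of a value of the Euler derivation. -/
theorem exists_eq_const_sub_euler [CharZero k] (f : 𝕊 k) :
    ∃ (c : k) (g : 𝕊 k), f = C c - LineArrangement.eulerDerivation k g := by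
  -- The component of degree $n+1$ is divided by $-(n+1)$; the shift by one leaves out degree zero,
  -- which the Euler derivation kills.
  refine ⟨coeff 0 f, ∑ n ∈ Finset.range f.totalDegree,
    C (-((n + 1 : ℕ) : k)⁻¹) * homogeneousComponent (n + 1) f, ?_⟩
  rw [map_sum]
  conv_lhs => rw [← sum_homogeneousComponent f, Finset.sum_range_succ', homogeneousComponent_zero]
  rw [add_comm, sub_eq_add_neg, ← Finset.sum_neg_distrib]
  congr 1
  refine Finset.sum_congr rfl fun n _ => ?_
  have hn : ((n + 1 : ℕ) : k) ≠ 0 := Nat.cast_ne_zero.2 n.succ_ne_zero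
  have hC : (((n + 1 : ℕ)) : 𝕊 k) = C ((n + 1 : ℕ) : k) := by simp
  rw [euler_of_isHomogeneous ((homogeneousComponent_isHomogeneous (n + 1) f).C_mul _),
    hC, ← mul_assoc, ← C_mul, ← neg_mul, ← C_neg, mul_neg, neg_neg, mul_inv_cancel₀ hn, C_1,
    one_mul]

theorem totalDegree_pderiv_lt {i : Fin 2} {p : 𝕊 k} (h : pderiv i p ≠ 0) :
    (pderiv i p).totalDegree < p.totalDegree := by
  obtain ⟨m, hm, hmax⟩ := Finset.exists_mem_eq_sup _ (support_nonempty.2 h)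
    (fun s : Fin 2 →₀ ℕ => s.sum fun _ e => e)
  have h1 : m + Finsupp.single i 1 ∈ p.support := by
    rw [mem_support_iff, coeff_pderiv] at hm
    exact mem_support_iff.2 (left_ne_zero_of_mul hm)
  have h2 := le_totalDegree h1
  rw [Finsupp.sum_add_index' (fun _ => rfl) (fun _ _ _ => rfl),
    Finsupp.sum_single_index rfl] at h2
  have h3 : (pderiv i p).totalDegree = m.sum fun _ e => e := hmax
  omega

/-- A nonzero partial derivative has smaller degree than the polynomial, so it cannot be a multiple
of it. -/
theorem pderiv_eq_zero_of_dvd {i : Fin 2} {p : 𝕊 k} (h : p ∣ pderiv i p) : pderiv i p = 0 := by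
  by_contra h0
  obtain ⟨q, hq⟩ := h
  have hlt := totalDegree_pderiv_lt h0
  have hp : p ≠ 0 := by rintro rfl; simp at h0
  have hq0 : q ≠ 0 := by rintro rfl; exact h0 (by rw [hq, mul_zero])
  rw [hq, totalDegree_mul_of_isDomain hp hq0] at hlt
  omega

theorem eq_C_of_pderiv_eq_zero [CharZero k] {p : 𝕊 k} (h : ∀ i, pderiv i p = 0) :
    p = C (coeff 0 p) := by
  have hE : LineArrangement.eulerDerivation k p = ((0 : ℕ) : 𝕊 k) * p := by
    rw [eulerDerivation_apply, h 0, h 1]; simp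
  exact totalDegree_eq_zero_iff_eq_C.1
    (Nat.le_zero.1 (isHomogeneous_of_euler hE).totalDegree_le)

theorem exists_eq_of_isHomogeneous_one {p : 𝕊 k} (hp : p.IsHomogeneous 1) :
    ∃ a b : k, p = C a * X 0 + C b * X 1 := by
  have h : p ∈ homogeneousSubmodule (Fin 2) k 1 := hp
  rw [homogeneousSubmodule_one_eq_span_X] at h
  induction h using Submodule.span_induction with
  | mem x hx =>
    obtain ⟨i, rfl⟩ := hx
    fin_cases i
    · exact ⟨1, 0, by simp⟩
    · exact ⟨0, 1, by simp⟩
  | zero => exact ⟨0, 0, by simp⟩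
  | add x y hx hy h₁ h₂ =>
    obtain ⟨a, b, rfl⟩ := h₁ (by
      rw [← mem_homogeneousSubmodule, homogeneousSubmodule_one_eq_span_X]; exact hx)
    obtain ⟨a', b', rfl⟩ := h₂ (by
      rw [← mem_homogeneousSubmodule, homogeneousSubmodule_one_eq_span_X]; exact hy)
    exact ⟨a + a', b + b', by simp only [C_add]; ring⟩
  | smul c x hx h₁ =>
    obtain ⟨a, b, rfl⟩ := h₁ (by
      rw [← mem_homogeneousSubmodule, homogeneousSubmodule_one_eq_span_X]; exact hx)
    exact ⟨c * a, c * b, by simp only [C_mul, smul_eq_C_mul]; ring⟩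

theorem irreducible_of_isHomogeneous_one {p : 𝕊 k} (hp : p.IsHomogeneous 1) (h0 : p ≠ 0) :
    Irreducible p := by
  refine irreducible_of_totalDegree_eq_one (hp.totalDegree h0) fun x hx => ?_
  obtain ⟨i, hi⟩ := ne_zero_iff.1 h0
  rcases eq_or_ne x 0 with rfl | hx0
  · exact absurd (zero_dvd_iff.1 (hx i)) hi
  · exact hx0.isUnit

theorem dvd_of_squarefree_of_irreducible_dvd {x y : 𝕊 k} (hx : Squarefree x)
    (h : ∀ p, Irreducible p → p ∣ x → p ∣ y) : x ∣ y := by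
  induction x using WfDvdMonoid.induction_on_irreducible with
  | zero => exact absurd hx not_squarefree_zero
  | unit u hu => exact hu.dvd
  | mul a p ha hp ih =>
    have h1 : a ∣ y := ih (hx.squarefree_of_dvd (dvd_mul_left a p))
      fun q hq hqa => h q hq (hqa.mul_left p)
    exact (IsRelPrime.of_squarefree_mul hx).mul_dvd (h p hp (dvd_mul_right p a)) h1

/-- The substitution `x ↦ a x + b y`, `y ↦ c x + d y`. -/
def subst (a b c d : k) : 𝕊 k →ₐ[k] 𝕊 k :=
  aeval ![C a * X 0 + C b * X 1, C c * X 0 + C d * X 1]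

@[simp] theorem subst_X_zero (a b c d : k) :
    subst a b c d (X 0) = C a * X 0 + C b * X 1 := by simp [subst]

@[simp] theorem subst_X_one (a b c d : k) :
    subst a b c d (X 1) = C c * X 0 + C d * X 1 := by simp [subst]

@[simp] theorem subst_C (a b c d e : k) : subst a b c d (C e) = C e := by
  simp [subst]

theorem algHom_ext₂ {B : Type*} [Semiring B] [Algebra k B] {f g : 𝕊 k →ₐ[k] B}
    (h₀ : f (X 0) = g (X 0)) (h₁ : f (X 1) = g (X 1)) : f = g := by
  have hX : ∀ i, f (X i) = g (X i) := fun i => by fin_cases i <;> assumption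
  refine AlgHom.ext fun p => ?_
  induction p using MvPolynomial.induction_on with
  | C e => rw [← algebraMap_eq, AlgHom.commutes, AlgHom.commutes]
  | add p q hp hq => rw [map_add, map_add, hp, hq]
  | mul_X p i hp => rw [map_mul, map_mul, hp, hX]

theorem subst_comp (a b c d a' b' c' d' : k) (f : 𝕊 k) :
    subst a b c d (subst a' b' c' d' f) =
      subst (a' * a + b' * c) (a' * b + b' * d) (c' * a + d' * c) (c' * b + d' * d) f := by
  rw [← AlgHom.comp_apply]
  congr 1
  apply algHom_ext₂
  · simp only [AlgHom.comp_apply, subst_X_zero, map_add, map_mul, subst_C, subst_X_one]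
    ring
  · simp only [AlgHom.comp_apply, subst_X_zero, map_add, map_mul, subst_C, subst_X_one]
    ring

theorem subst_one (f : 𝕊 k) : subst 1 0 0 1 f = f := by
  have : subst 1 0 0 1 = AlgHom.id k (𝕊 k) := algHom_ext₂ (by simp) (by simp)
  rw [this, AlgHom.id_apply]

theorem subst_of_eq {a b c d : k} (ha : a = 1) (hb : b = 0) (hc : c = 0) (hd : d = 1) (f : 𝕊 k) :
    subst a b c d f = f := by
  subst ha hb hc hd
  exact subst_one f

/-- The linear substitution with an invertible matrix, as an automorphism of `k[x, y]`. -/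
def substEquiv (a b c d : k) (h : a * d - b * c ≠ 0) : 𝕊 k ≃ₐ[k] 𝕊 k :=
  AlgEquiv.ofAlgHom (subst a b c d)
    (subst (d / (a * d - b * c)) (-b / (a * d - b * c)) (-c / (a * d - b * c))
      (a / (a * d - b * c)))
    (AlgHom.ext fun f => by
      rw [AlgHom.comp_apply, subst_comp]
      exact subst_of_eq 
        (by rw [← mul_inv_cancel₀ h]; ring) (by ring) (by ring) (by rw [← mul_inv_cancel₀ h]; ring) f)
    (AlgHom.ext fun f => by
      rw [AlgHom.comp_apply, subst_comp]
      exact subst_of_eq 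
        (by rw [← mul_inv_cancel₀ h]; ring) (by ring) (by ring) (by rw [← mul_inv_cancel₀ h]; ring) f)

theorem substEquiv_apply (a b c d : k) (h : a * d - b * c ≠ 0) (f : 𝕊 k) :
    substEquiv a b c d h f = subst a b c d f := rfl

theorem substEquiv_symm_apply (a b c d : k) (h : a * d - b * c ≠ 0) (f : 𝕊 k) :
    (substEquiv a b c d h).symm f = subst (d / (a * d - b * c)) (-b / (a * d - b * c))
      (-c / (a * d - b * c)) (a / (a * d - b * c)) f := rfl

/-- Linear forms are fixed by the Euler derivation, so both sides agree on the variables. -/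
theorem euler_subst (a b c d : k) (f : 𝕊 k) :
    LineArrangement.eulerDerivation k (subst a b c d f) =
      subst a b c d (LineArrangement.eulerDerivation k f) := by
  induction f using MvPolynomial.induction_on with
  | C e => simp
  | add p q hp hq => simp only [map_add, hp, hq]
  | mul_X p i hp =>
    have hX : LineArrangement.eulerDerivation k (subst a b c d (X i)) =
        subst a b c d (LineArrangement.eulerDerivation k (X i)) := by
      fin_cases i
      · simp [eulerDerivation_apply, pderiv_X, mul_comm]
      · simp [eulerDerivation_apply, pderiv_X, mul_comm]
    simp only [map_mul, Derivation.leibniz, hp, hX, smul_eq_mul, map_add]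

end PlanePoly

/-! ### Tangent derivations, generators and relations of the algebra. -/

namespace LineArrangement

open PlanePoly

variable {k : Type*} [Field k] {r : ℕ} (𝓐 : LineArrangement k r)

theorem F_ne_zero : 𝓐.F ≠ 0 := 𝓐.squarefree.ne_zero

theorem Q_ne_zero : 𝓐.Q ≠ 0 := mul_ne_zero (X_ne_zero 0) 𝓐.F_ne_zero

theorem Q_squarefree : Squarefree 𝓐.Q := by
  have hX : Irreducible (X 0 : 𝕊 k) := X_prime.irreducible
  exact squarefree_mul_iff.2 ⟨hX.isRelPrime_iff_not_dvd.2 𝓐.not_dvd, hX.squarefree, 𝓐.squarefree⟩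

theorem X_dvd_Q : X 0 ∣ 𝓐.Q := dvd_mul_right _ _

theorem F_dvd_Q : 𝓐.F ∣ 𝓐.Q := dvd_mul_left _ _

/-- An irreducible factor of `F` is a linear form which is not a multiple of `x`. -/
theorem exists_eq_of_dvd_F {p : 𝕊 k} (hp : Irreducible p) (h : p ∣ 𝓐.F) :
    ∃ a b : k, b ≠ 0 ∧ p = C a * X 0 + C b * X 1 := by
  obtain ⟨α, hα, hF⟩ := 𝓐.linear_factors
  rw [hF] at h
  obtain ⟨i, -, hi⟩ := (hp.prime.dvd_finsetProd_iff _).1 h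
  have hαF : α i ∣ 𝓐.F := hF ▸ Finset.dvd_prod_of_mem α (Finset.mem_univ i)
  have h0 : α i ≠ 0 := ne_zero_of_dvd_ne_zero 𝓐.F_ne_zero hαF
  have hirr := irreducible_of_isHomogeneous_one (hα i) h0
  have hass : Associated (α i) p :=
    hirr.associated_of_dvd hp ((hp.associated_of_dvd hirr hi).symm.dvd)
  obtain ⟨u, hu⟩ := hass
  obtain ⟨c, hc, hcu⟩ := (isUnit_iff_eq_C_of_isReduced).1 u.isUnit
  obtain ⟨a, b, hab⟩ := exists_eq_of_isHomogeneous_one (hα i)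
  refine ⟨a * c, b * c, ?_, ?_⟩
  · intro hbc
    have hb : b = 0 := (mul_eq_zero.1 hbc).resolve_right hc.ne_zero
    exact 𝓐.not_dvd (dvd_trans ⟨C a, by rw [hab, hb, C_0]; ring⟩ hαF)
  · rw [← hu, hcu, hab, C_mul, C_mul]
    ring

theorem exists_irreducible_dvd_F : ∃ p : 𝕊 k, Irreducible p ∧ p ∣ 𝓐.F := by
  refine WfDvdMonoid.exists_irreducible_factor (fun hu => ?_) 𝓐.F_ne_zero
  have h := 𝓐.homogeneous.totalDegree 𝓐.F_ne_zero
  rw [(isUnit_iff_totalDegree_of_isReduced.1 hu).2] at h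
  omega

theorem exists_eq_of_dvd_Q {p : 𝕊 k} (hp : Irreducible p) (h : p ∣ 𝓐.Q) :
    ∃ a b : k, p = C a * X 0 + C b * X 1 := by
  rcases hp.prime.dvd_or_dvd h with h | h
  · obtain ⟨u, hu⟩ := (X_prime.irreducible.associated_of_dvd hp
      ((hp.associated_of_dvd X_prime.irreducible h).symm.dvd) : Associated (X 0 : 𝕊 k) p)
    obtain ⟨c, -, hcu⟩ := (isUnit_iff_eq_C_of_isReduced).1 u.isUnit
    exact ⟨c, 0, by rw [← hu, hcu, C_0]; ring⟩
  · obtain ⟨a, b, -, hab⟩ := 𝓐.exists_eq_of_dvd_F hp h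
    exact ⟨a, b, hab⟩

/-- If $p=ax+by$ divides $F=pG$, then $\partial_yF\equiv bG$ modulo $p$. As $b\ne0$, a common factor
$p$ would divide $G$, against square-freeness. -/
theorem isRelPrime_pderiv_F : IsRelPrime 𝓐.F (pderiv 1 𝓐.F) := by
  refine WfDvdMonoid.isRelPrime_of_no_irreducible_factors (fun h => 𝓐.F_ne_zero h.1) ?_
  rintro p hp ⟨G, hG⟩ hpd
  obtain ⟨a, b, hb, hab⟩ := 𝓐.exists_eq_of_dvd_F hp ⟨G, hG⟩
  have hp1 : pderiv 1 p = C b := by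
    rw [hab]
    simp [pderiv_X]
  rw [hG, pderiv_mul, hp1, dvd_add_left (dvd_mul_right p _)] at hpd
  have hpG : p ∣ G := (hp.prime.dvd_or_dvd hpd).resolve_left fun h =>
    hp.not_isUnit (isUnit_of_dvd_unit h ((isUnit_iff_ne_zero.2 hb).map C))
  obtain ⟨H, hH⟩ := hpG
  exact hp.not_isUnit (𝓐.squarefree p ⟨H, by rw [hG, hH]; ring⟩)

theorem euler_F : eulerDerivation k 𝓐.F = ((r + 1 : ℕ) : 𝕊 k) * 𝓐.F :=
  euler_of_isHomogeneous 𝓐.homogeneous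

theorem verticalDerivation_apply (f : 𝕊 k) : 𝓐.verticalDerivation f = 𝓐.F * pderiv 1 f := rfl

/-- The tangent derivations are a free module on the Euler derivation and `F ∂/∂y`. -/
theorem exists_eq_of_mem_tangentDerivations {d : Derivation k (𝕊 k) (𝕊 k)}
    (hd : d ∈ 𝓐.tangentDerivations) :
    ∃ m n : 𝕊 k, d = m • eulerDerivation k + n • 𝓐.verticalDerivation := by
  have hX : Prime (X 0 : 𝕊 k) := X_prime
  have h : 𝓐.Q ∣ d 𝓐.Q := hd
  rw [Q, Derivation.leibniz, smul_eq_mul, smul_eq_mul] at h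
  -- Reduction of $d(Q)=x\,d(F)+F\,d(x)$ modulo $x$ gives $d(x)=mx$; reduction modulo $F$ then gives
  -- $F\mid d(F)$.
  have h₀ : X 0 ∣ 𝓐.F * d (X 0) :=
    (dvd_add_right (dvd_mul_right _ _)).1 ((dvd_mul_right _ _).trans h)
  obtain ⟨m, hm⟩ := (hX.dvd_or_dvd h₀).resolve_left 𝓐.not_dvd
  have h₁ : 𝓐.F ∣ d 𝓐.F := by
    rw [hm, show X 0 * d 𝓐.F + 𝓐.F * (X 0 * m) = X 0 * (d 𝓐.F + 𝓐.F * m) by ring] at h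
    exact (dvd_add_left (dvd_mul_right _ _)).1 ((mul_dvd_mul_iff_left (X_ne_zero 0)).1 h)
  -- The difference kills $x$, so it is a multiple of $\partial_y$. It still maps $F$ into $FS$, and
  -- $F$ is prime to $\partial_yF$, so the multiplier is divisible by $F$.
  set d' := d - m • eulerDerivation k with hd'
  have h₂ : d' (X 0) = 0 := by
    simp [hd', eulerDerivation_apply, hm, pderiv_X]
    ring
  have h₃ : d' = d' (X 1) • (pderiv 1 : Derivation k (𝕊 k) (𝕊 k)) :=
    PlanePoly.derivation_ext (by simp [h₂, pderiv_X]) (by simp)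
  have h₄ : 𝓐.F ∣ d' 𝓐.F := by
    rw [hd', Derivation.sub_apply, Derivation.smul_apply, euler_F, smul_eq_mul]
    exact dvd_sub h₁ ⟨m * ((r + 1 : ℕ) : 𝕊 k), by ring⟩
  rw [h₃, Derivation.smul_apply, smul_eq_mul] at h₄
  obtain ⟨n, hn⟩ := 𝓐.isRelPrime_pderiv_F.dvd_of_dvd_mul_right h₄
  refine ⟨m, n, ?_⟩
  rw [eq_add_of_sub_eq' hd'.symm, h₃, hn]
  refine PlanePoly.derivation_ext ?_ ?_ <;>
  · simp [verticalDerivation]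
    try ring

section Algebra

theorem toEnd_injective : Function.Injective 𝓐.toEnd := Subtype.val_injective

@[simp] theorem toEnd_ofPoly (f g : 𝕊 k) : 𝓐.toEnd (𝓐.ofPoly f) g = f * g := rfl

@[simp] theorem toEnd_E (f : 𝕊 k) : 𝓐.toEnd 𝓐.E f = eulerDerivation k f := rfl

@[simp] theorem toEnd_D (f : 𝕊 k) : 𝓐.toEnd 𝓐.D f = 𝓐.verticalDerivation f := rfl

theorem toEnd_ext {s t : 𝓐.DiffAlg} (h : ∀ f, 𝓐.toEnd s f = 𝓐.toEnd t f) : s = t :=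
  𝓐.toEnd_injective (LinearMap.ext h)

theorem ofPoly_injective : Function.Injective 𝓐.ofPoly := fun f g h => by
  simpa using congrArg (fun t => 𝓐.toEnd t 1) h

theorem ofPoly_C (c : k) : 𝓐.ofPoly (C c) = algebraMap k 𝓐.DiffAlg c :=
  𝓐.ofPoly.commutes c

theorem E_mul_ofPoly (f : 𝕊 k) :
    𝓐.E * 𝓐.ofPoly f = 𝓐.ofPoly f * 𝓐.E + 𝓐.ofPoly (eulerDerivation k f) := by
  refine 𝓐.toEnd_ext fun g => ?_
  simp only [map_mul, map_add, Module.End.mul_apply, LinearMap.add_apply, toEnd_ofPoly, toEnd_E,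
    Derivation.leibniz, smul_eq_mul]
  ring

theorem D_mul_ofPoly (f : 𝕊 k) :
    𝓐.D * 𝓐.ofPoly f = 𝓐.ofPoly f * 𝓐.D + 𝓐.ofPoly (𝓐.verticalDerivation f) := by
  refine 𝓐.toEnd_ext fun g => ?_
  simp only [map_mul, map_add, Module.End.mul_apply, LinearMap.add_apply, toEnd_ofPoly, toEnd_D,
    Derivation.leibniz, smul_eq_mul]
  ring

theorem euler_vertical (f : 𝕊 k) :
    eulerDerivation k (𝓐.verticalDerivation f) =
      𝓐.verticalDerivation (eulerDerivation k f) + (r : 𝕊 k) * 𝓐.verticalDerivation f := by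
  have h : ⁅eulerDerivation k, 𝓐.verticalDerivation⁆ =
      (r : 𝕊 k) • 𝓐.verticalDerivation := by
    refine PlanePoly.derivation_ext ?_ ?_
    · simp [Derivation.commutator_apply, verticalDerivation_apply, eulerDerivation_apply, pderiv_X]
    · have h1 := 𝓐.euler_F
      rw [eulerDerivation_apply] at h1
      simp [Derivation.commutator_apply, verticalDerivation_apply, eulerDerivation_apply, pderiv_X,
        h1]
      ring
  have h' := congrArg (fun d : Derivation k (𝕊 k) (𝕊 k) => d f) h
  simp only [Derivation.commutator_apply, Derivation.smul_apply, smul_eq_mul] at h'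
  rw [← h']
  ring

theorem E_mul_D : 𝓐.E * 𝓐.D = 𝓐.D * 𝓐.E + (r : 𝓐.DiffAlg) * 𝓐.D := by
  refine 𝓐.toEnd_ext fun g => ?_
  have h := 𝓐.euler_vertical g
  have hr : (r : 𝓐.DiffAlg) = 𝓐.ofPoly (r : 𝕊 k) := by simp
  rw [hr]
  simpa only [map_mul, map_add, Module.End.mul_apply, LinearMap.add_apply, toEnd_E, toEnd_D,
    toEnd_ofPoly] using h

theorem toEnd_surjOn {T : Module.End k (𝕊 k)} (h : T ∈ 𝓐.diffOps) : ∃ t, 𝓐.toEnd t = T :=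
  ⟨⟨T, h⟩, rfl⟩

theorem toEnd_mem (t : 𝓐.DiffAlg) : 𝓐.toEnd t ∈ 𝓐.diffOps := t.2

/-- The algebra of differential operators is generated by `S`, `E` and `D`. -/
theorem induction_on {P : 𝓐.DiffAlg → Prop} (poly : ∀ f, P (𝓐.ofPoly f)) (hE : P 𝓐.E)
    (hD : P 𝓐.D) (add : ∀ s t, P s → P t → P (s + t)) (mul : ∀ s t, P s → P t → P (s * t))
    (t : 𝓐.DiffAlg) : P t := by
  suffices H : ∀ T ∈ 𝓐.diffOps, ∀ t, 𝓐.toEnd t = T → P t from H _ (𝓐.toEnd_mem t) t rfl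
  intro T hT
  induction hT using Algebra.adjoin_induction with
  | mem T hT =>
    rintro t rfl
    rcases hT with ⟨f, hf⟩ | ⟨d, hd, hT⟩
    · rw [𝓐.toEnd_injective (a₁ := t) (a₂ := 𝓐.ofPoly f) hf.symm]
      exact poly f
    · obtain ⟨m, n, hmn⟩ := 𝓐.exists_eq_of_mem_tangentDerivations hd
      have ht : t = 𝓐.ofPoly m * 𝓐.E + 𝓐.ofPoly n * 𝓐.D := by
        refine 𝓐.toEnd_ext fun g => ?_
        rw [hT, hmn]
        rfl
      rw [ht]
      exact add _ _ (mul _ _ (poly m) hE) (mul _ _ (poly n) hD)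
  | algebraMap c =>
    intro t ht
    rw [𝓐.toEnd_injective (a₁ := t) (a₂ := algebraMap k _ c) (by rw [ht, AlgHom.commutes]),
      ← ofPoly_C]
    exact poly _
  | add S T hS hT h₁ h₂ =>
    intro t ht
    obtain ⟨s, rfl⟩ := 𝓐.toEnd_surjOn hS
    obtain ⟨s', rfl⟩ := 𝓐.toEnd_surjOn hT
    rw [𝓐.toEnd_injective (a₁ := t) (a₂ := s + s') (by rw [ht, map_add])]
    exact add _ _ (h₁ s rfl) (h₂ s' rfl)
  | mul S T hS hT h₁ h₂ =>
    intro t ht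
    obtain ⟨s, rfl⟩ := 𝓐.toEnd_surjOn hS
    obtain ⟨s', rfl⟩ := 𝓐.toEnd_surjOn hT
    rw [𝓐.toEnd_injective (a₁ := t) (a₂ := s * s') (by rw [ht, map_mul])]
    exact mul _ _ (h₁ s rfl) (h₂ s' rfl)

theorem algHom_ext {B : Type*} [Semiring B] [Algebra k B] {f g : 𝓐.DiffAlg →ₐ[k] B}
    (h₀ : f (𝓐.ofPoly (X 0)) = g (𝓐.ofPoly (X 0))) (h₁ : f (𝓐.ofPoly (X 1)) = g (𝓐.ofPoly (X 1)))
    (hE : f 𝓐.E = g 𝓐.E) (hD : f 𝓐.D = g 𝓐.D) : f = g := by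
  have h : f.comp 𝓐.ofPoly = g.comp 𝓐.ofPoly := algHom_ext₂ h₀ h₁
  refine AlgHom.ext fun t => ?_
  induction t using 𝓐.induction_on with
  | poly p => exact DFunLike.congr_fun h p
  | hE => exact hE
  | hD => exact hD
  | add s t hs ht => rw [map_add, map_add, hs, ht]
  | mul s t hs ht => rw [map_mul, map_mul, hs, ht]

theorem algEquiv_ext {f g : 𝓐.DiffAlg ≃ₐ[k] 𝓐.DiffAlg}
    (h₀ : f (𝓐.ofPoly (X 0)) = g (𝓐.ofPoly (X 0))) (h₁ : f (𝓐.ofPoly (X 1)) = g (𝓐.ofPoly (X 1)))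
    (hE : f 𝓐.E = g 𝓐.E) (hD : f 𝓐.D = g 𝓐.D) : f = g := by
  have h := 𝓐.algHom_ext (f := f.toAlgHom) (g := g.toAlgHom) h₀ h₁ hE hD
  exact AlgEquiv.ext fun t => DFunLike.congr_fun h t

/-- The multiplication operators are their own centralizer. -/
theorem eq_ofPoly_of_commute {t : 𝓐.DiffAlg}
    (h : ∀ i, t * 𝓐.ofPoly (X i) = 𝓐.ofPoly (X i) * t) : t = 𝓐.ofPoly (𝓐.toEnd t 1) := by
  refine 𝓐.toEnd_ext fun f => ?_
  induction f using MvPolynomial.induction_on with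
  | C c => rw [← mul_one (C c), ← smul_eq_C_mul, map_smul, map_smul, toEnd_ofPoly, mul_one]
  | add p q hp hq => rw [map_add, map_add, hp, hq]
  | mul_X p i hp =>
    have h' := congrArg (fun t => 𝓐.toEnd t p) (h i)
    simp only [map_mul, Module.End.mul_apply, toEnd_ofPoly] at h'
    rw [mul_comm p, h', hp, toEnd_ofPoly, toEnd_ofPoly]
    ring

end Algebra

end LineArrangement

/-! ### Locally nilpotent derivations and their exponentials. -/

section Derivations

variable {k : Type*} [Field k] {B : Type*} [Ring B] [Algebra k B]

theorem leibniz_pow {δ : Module.End k B} (hδ : ∀ s t, δ (s * t) = δ s * t + s * δ t) (n : ℕ)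
    (s t : B) : (δ ^ n) (s * t) =
      ∑ p ∈ Finset.HasAntidiagonal.antidiagonal n, n.choose p.1 • ((δ ^ p.1) s * (δ ^ p.2) t) := by
  induction n generalizing s t with
  | zero => simp
  | succ n ih =>
    rw [Finset.sum_antidiagonal_choose_succ_nsmul (fun i j => (δ ^ i) s * (δ ^ j) t), pow_succ,
      Module.End.mul_apply, hδ, map_add, ih, ih, add_comm]
    simp only [pow_succ, Module.End.mul_apply]
    congr 1
    refine Finset.sum_congr rfl fun p hp => ?_
    rw [Nat.choose_symm_of_eq_add (Finset.HasAntidiagonal.mem_antidiagonal.1 hp).symm]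

theorem pow_apply_eq_zero_of_le {δ : Module.End k B} {m n : ℕ} {t : B} (h : (δ ^ m) t = 0)
    (hmn : m ≤ n) : (δ ^ n) t = 0 := by
  obtain ⟨c, rfl⟩ := Nat.exists_eq_add_of_le' hmn
  rw [pow_add, Module.End.mul_apply, h, map_zero]

theorem leibniz_pow_eq_zero {δ : Module.End k B} (hδ : ∀ s t, δ (s * t) = δ s * t + s * δ t)
    {m n : ℕ} {s t : B} (hs : (δ ^ m) s = 0) (ht : (δ ^ n) t = 0) : (δ ^ (m + n)) (s * t) = 0 := by
  rw [leibniz_pow hδ]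
  refine Finset.sum_eq_zero fun p hp => ?_
  rw [Finset.HasAntidiagonal.mem_antidiagonal] at hp
  rcases le_or_gt m p.1 with h | h
  · rw [pow_apply_eq_zero_of_le hs h, zero_mul, smul_zero]
  · rw [pow_apply_eq_zero_of_le ht (by omega : n ≤ p.2), mul_zero, smul_zero]

/-- In the Leibniz expansion every term other than $(m,n)$ has too high a power on one factor. In a
domain of characteristic zero this makes the nilpotency order additive on products, like a degree.
-/
theorem leibniz_pow_top {δ : Module.End k B} (hδ : ∀ s t, δ (s * t) = δ s * t + s * δ t)
    {m n : ℕ} {s t : B} (hs : (δ ^ (m + 1)) s = 0) (ht : (δ ^ (n + 1)) t = 0) :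
    (δ ^ (m + n)) (s * t) = (m + n).choose m • ((δ ^ m) s * (δ ^ n) t) := by
  rw [leibniz_pow hδ]
  refine Finset.sum_eq_single_of_mem (m, n) (by simp) fun p hp hne => ?_
  rw [Finset.HasAntidiagonal.mem_antidiagonal] at hp
  rcases le_or_gt (m + 1) p.1 with h | h
  · rw [pow_apply_eq_zero_of_le hs h, zero_mul, smul_zero]
  · have h2 : n + 1 ≤ p.2 := by
      by_contra h3
      exact hne (Prod.ext (by simp only; omega) (by simp only; omega))
    rw [pow_apply_eq_zero_of_le ht h2, mul_zero, smul_zero]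

theorem exists_pow_ne_zero {δ : Module.End k B} {t : B} (ht : t ≠ 0) (h : ∃ n, (δ ^ n) t = 0) :
    ∃ n, (δ ^ n) t ≠ 0 ∧ (δ ^ (n + 1)) t = 0 := by
  classical
  have h0 : Nat.find h ≠ 0 := fun h0 => ht (by simpa [h0] using Nat.find_spec h)
  obtain ⟨n, hn⟩ := Nat.exists_eq_succ_of_ne_zero h0
  exact ⟨n, Nat.find_min h (by omega), by simpa [hn] using Nat.find_spec h⟩

/-- If `δ s` is a right multiple of `s`, for a locally nilpotent derivation `δ` of a domain of
characteristic zero, then `δ s = 0`. -/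
theorem apply_eq_zero_of_eq_mul [CharZero k] [NoZeroDivisors B] {δ : Module.End k B}
    (hδ : ∀ s t, δ (s * t) = δ s * t + s * δ t) (hnil : ∀ t, ∃ n, (δ ^ n) t = 0) {s t : B}
    (h : δ s = s * t) : δ s = 0 := by
  by_contra h0
  have hs : s ≠ 0 := by rintro rfl; exact h0 (map_zero δ)
  have ht : t ≠ 0 := by rintro rfl; exact h0 (by rw [h, mul_zero])
  obtain ⟨m, hm, hm'⟩ := exists_pow_ne_zero hs (hnil s)
  obtain ⟨n, hn, hn'⟩ := exists_pow_ne_zero ht (hnil t)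
  -- If $s$ and $t$ have degrees $m$ and $n$, then $st$ has degree $m+n\ge m$, whereas $\delta s$
  -- has degree below $m$.
  have h1 := leibniz_pow_top hδ hm' hn'
  rw [← h, ← Module.End.mul_apply, ← pow_succ,
    pow_apply_eq_zero_of_le hm' (by omega), eq_comm, ← Nat.cast_smul_eq_nsmul k] at h1
  rcases smul_eq_zero.1 h1 with h1 | h1
  · exact (Nat.choose_pos (Nat.le_add_right m n)).ne' (by exact_mod_cast h1)
  · exact mul_ne_zero hm hn h1

/-- The exponential of a locally nilpotent endomorphism. -/
def locExp (δ : Module.End k B) (t : B) : B := ∑ᶠ n : ℕ, ((n.factorial : k)⁻¹) • (δ ^ n) t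

theorem locExp_eq_sum {δ : Module.End k B} {N : ℕ} {t : B} (h : (δ ^ N) t = 0) :
    locExp δ t = ∑ n ∈ Finset.range N, ((n.factorial : k)⁻¹) • (δ ^ n) t := by
  refine finsum_eq_sum_of_support_subset _ fun n hn => ?_
  by_contra hn'
  rw [Finset.mem_coe, Finset.mem_range, not_lt] at hn'
  exact hn (by simp only [pow_apply_eq_zero_of_le h hn', smul_zero])

theorem locExp_add {δ : Module.End k B} (hnil : ∀ t, ∃ n, (δ ^ n) t = 0) (s t : B) :
    locExp δ (s + t) = locExp δ s + locExp δ t := by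
  obtain ⟨m, hm⟩ := hnil s
  obtain ⟨n, hn⟩ := hnil t
  have hm' := pow_apply_eq_zero_of_le hm (le_max_left m n)
  have hn' := pow_apply_eq_zero_of_le hn (le_max_right m n)
  rw [locExp_eq_sum hm', locExp_eq_sum hn',
    locExp_eq_sum (N := max m n) (by rw [map_add, hm', hn', add_zero]), ← Finset.sum_add_distrib]
  simp only [map_add, smul_add]

theorem locExp_of_apply_eq_zero {δ : Module.End k B} {t : B} (h : δ t = 0) : locExp δ t = t := by
  rw [locExp_eq_sum (N := 1) (by rwa [pow_one])]
  simp

theorem locExp_of_sq {δ : Module.End k B} {t : B} (h : δ (δ t) = 0) : locExp δ t = t + δ t := by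
  rw [locExp_eq_sum (N := 2) (by rwa [pow_two])]
  simp [Finset.sum_range_succ]

theorem locExp_mul [CharZero k] {δ : Module.End k B} (hδ : ∀ s t, δ (s * t) = δ s * t + s * δ t)
    (hnil : ∀ t, ∃ n, (δ ^ n) t = 0) (s t : B) :
    locExp δ (s * t) = locExp δ s * locExp δ t := by
  obtain ⟨m, hm⟩ := hnil s
  obtain ⟨n, hn⟩ := hnil t
  have h0 : ∀ p : ℕ × ℕ, m ≤ p.1 ∨ n ≤ p.2 → (δ ^ p.1) s * (δ ^ p.2) t = 0 := by
    rintro p (h | h)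
    · rw [pow_apply_eq_zero_of_le hm h, zero_mul]
    · rw [pow_apply_eq_zero_of_le hn h, mul_zero]
  rw [locExp_eq_sum hm, locExp_eq_sum hn, locExp_eq_sum (leibniz_pow_eq_zero hδ hm hn),
    Finset.sum_mul_sum, ← Finset.sum_product']
  have h1 : ∀ i : ℕ, ((i.factorial : k)⁻¹) • (δ ^ i) (s * t) =
      ∑ p ∈ Finset.HasAntidiagonal.antidiagonal i, ((p.1.factorial : k)⁻¹ • (δ ^ p.1) s) *
        ((p.2.factorial : k)⁻¹ • (δ ^ p.2) t) := by
    intro i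
    rw [leibniz_pow hδ, Finset.smul_sum]
    refine Finset.sum_congr rfl fun p hp => ?_
    rw [Finset.HasAntidiagonal.mem_antidiagonal] at hp
    rw [smul_mul_smul_comm, ← Nat.cast_smul_eq_nsmul k, smul_smul]
    congr 1
    have hi : (i.factorial : k) ≠ 0 := Nat.cast_ne_zero.2 i.factorial_ne_zero
    have h1 : (p.1.factorial : k) ≠ 0 := Nat.cast_ne_zero.2 p.1.factorial_ne_zero
    have h2 : (p.2.factorial : k) ≠ 0 := Nat.cast_ne_zero.2 p.2.factorial_ne_zero
    have h3 : (i.choose p.1 : k) * p.1.factorial * p.2.factorial = i.factorial := by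
      rw [← hp, Nat.choose_symm_add]
      exact_mod_cast Nat.add_choose_mul_factorial_mul_factorial p.1 p.2
    rw [← h3]
    rw [← h3] at hi
    have hc := left_ne_zero_of_mul (left_ne_zero_of_mul hi)
    field_simp
  simp only [h1]
  -- Cauchy product: the rectangle $m\times n$ embeds in the union of the antidiagonals, and the
  -- terms outside it vanish by `h0`.
  rw [Finset.sum_sigma']
  refine (Finset.sum_of_injOn (fun p : ℕ × ℕ => (⟨p.1 + p.2, p⟩ : Σ _ : ℕ, ℕ × ℕ)) ?_ ?_ ?_ ?_).symm
  · rintro p - q - h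
    simp only [Sigma.mk.injEq] at h
    exact eq_of_heq h.2
  · rintro p hp
    simp only [Finset.coe_product, Set.mem_prod, Finset.mem_coe, Finset.mem_range] at hp
    simp only [Finset.mem_coe, Finset.mem_sigma, Finset.mem_range,
      Finset.HasAntidiagonal.mem_antidiagonal, and_true]
    omega
  · rintro ⟨i, p⟩ hp hne
    simp only [Finset.mem_sigma, Finset.mem_range, Finset.HasAntidiagonal.mem_antidiagonal] at hp
    obtain ⟨hi, rfl⟩ := hp
    rw [smul_mul_smul_comm, h0 p, smul_zero]
    by_contra! hlt
    exact hne ⟨p, by simpa using hlt, rfl⟩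
  · exact fun _ _ => rfl

end Derivations

/-! ### Independence of powers over the constants of a derivation. -/

section TriangularExpressions

variable {k : Type*} [Field k] {B : Type*} [Ring B] [Algebra k B]

theorem pow_apply_pow {δ : Module.End k B} (hδ : ∀ s t, δ (s * t) = δ s * t + s * δ t)
    {T : B} (hT : δ (δ T) = 0) (n : ℕ) :
    (δ ^ n) (T ^ n) = n.factorial • (δ T) ^ n ∧ (δ ^ (n + 1)) (T ^ n) = 0 := by
  induction n with
  | zero =>
    have h1 : δ 1 = 0 := by simpa using hδ 1 1
    exact ⟨by simp, by simpa using h1⟩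
  | succ n ih =>
    have hT' : (δ ^ 2) T = 0 := by rwa [pow_two, Module.End.mul_apply]
    rw [pow_succ' T]
    constructor
    · rw [add_comm n 1, leibniz_pow_top hδ hT' ih.2, ih.1, pow_one, Nat.choose_one_right,
        mul_smul_comm, smul_smul, add_comm 1 n, Nat.factorial_succ, ← pow_succ']
    · rw [leibniz_pow hδ]
      refine Finset.sum_eq_zero fun p hp => ?_
      rw [Finset.HasAntidiagonal.mem_antidiagonal] at hp
      rcases le_or_gt 2 p.1 with h | h
      · rw [pow_apply_eq_zero_of_le hT' h, zero_mul, smul_zero]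
      · rw [pow_apply_eq_zero_of_le ih.2 (by omega : n + 1 ≤ p.2), mul_zero, smul_zero]

/-- The powers of `T` are linearly independent over the constants of a derivation `δ` for which
`δ T` is a nonzero constant. -/
theorem eq_zero_of_sum_mul_pow_eq_zero [CharZero k] [NoZeroDivisors B] {δ : Module.End k B}
    (hδ : ∀ s t, δ (s * t) = δ s * t + s * δ t) {T : B} (hT₀ : δ T ≠ 0) (hT : δ (δ T) = 0)
    {c : ℕ → B} (hc : ∀ i, δ (c i) = 0) {n : ℕ} (h : ∑ i ∈ Finset.range n, c i * T ^ i = 0) :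
    ∀ i < n, c i = 0 := by
  have hcT : ∀ (m : ℕ) (a b : B), δ a = 0 → (δ ^ m) (a * b) = a * (δ ^ m) b := by
    intro m a b ha
    induction m with
    | zero => simp
    | succ m ih => rw [pow_succ', Module.End.mul_apply, ih, hδ, ha, zero_mul, zero_add,
        Module.End.mul_apply]
  induction n with
  | zero => intro i hi; omega
  | succ n ih =>
    have htop : c n = 0 := by
      -- $\delta^n$ kills the lower powers of $T$ and turns the top term into $n!\,c_n(\delta T)^n$.
      have h' := congrArg (δ ^ n) h
      rw [Finset.sum_range_succ, map_add, map_sum, map_zero, Finset.sum_eq_zero, zero_add,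
        hcT _ _ _ (hc n), (pow_apply_pow hδ hT n).1, ← Nat.cast_smul_eq_nsmul k,
        mul_smul_comm] at h'
      · rcases smul_eq_zero.1 h' with h' | h'
        · exact absurd h' (Nat.cast_ne_zero.2 n.factorial_ne_zero)
        · exact (mul_eq_zero.1 h').resolve_right (pow_ne_zero n hT₀)
      · intro i hi
        rw [hcT _ _ _ (hc i), pow_apply_eq_zero_of_le (pow_apply_pow hδ hT i).2
          (Finset.mem_range.1 hi), mul_zero]
    rw [Finset.sum_range_succ, htop, zero_mul, add_zero] at h
    intro i hi
    rcases Nat.lt_succ_iff_lt_or_eq.1 hi with hi | rfl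
    · exact ih h i hi
    · exact htop

end TriangularExpressions

/-! ### The domain property, normal elements and locally ad-nilpotent elements. -/

namespace LineArrangement

open PlanePoly

variable {k : Type*} [Field k] {r : ℕ} (𝓐 : LineArrangement k r)

theorem ad_apply (u t : 𝓐.DiffAlg) : 𝓐.ad u t = u * t - t * u := rfl

theorem ad_mul (u s t : 𝓐.DiffAlg) : 𝓐.ad u (s * t) = 𝓐.ad u s * t + s * 𝓐.ad u t := by
  simp only [ad_apply]
  noncomm_ring

theorem expAd_eq_locExp (u : 𝓐.DiffAlg) : 𝓐.expAd u = locExp (𝓐.ad u) := rfl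

theorem ad_ofPoly_ofPoly (f g : 𝕊 k) : 𝓐.ad (𝓐.ofPoly f) (𝓐.ofPoly g) = 0 := by
  rw [ad_apply, ← map_mul, ← map_mul, mul_comm, sub_self]

theorem ad_ofPoly_E (f : 𝕊 k) : 𝓐.ad (𝓐.ofPoly f) 𝓐.E = -𝓐.ofPoly (eulerDerivation k f) := by
  rw [ad_apply, E_mul_ofPoly]
  abel

theorem ad_ofPoly_D (f : 𝕊 k) :
    𝓐.ad (𝓐.ofPoly f) 𝓐.D = -𝓐.ofPoly (𝓐.verticalDerivation f) := by
  rw [ad_apply, D_mul_ofPoly]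
  abel

theorem isLocallyAdNilpotent_ofPoly (f : 𝕊 k) : 𝓐.IsLocallyAdNilpotent (𝓐.ofPoly f) := by
  intro t
  induction t using 𝓐.induction_on with
  | poly g => exact ⟨1, by rw [pow_one, ad_ofPoly_ofPoly]⟩
  | hE => exact ⟨2, by rw [pow_two, Module.End.mul_apply, ad_ofPoly_E, map_neg, ad_ofPoly_ofPoly,
      neg_zero]⟩
  | hD => exact ⟨2, by rw [pow_two, Module.End.mul_apply, ad_ofPoly_D, map_neg, ad_ofPoly_ofPoly,
      neg_zero]⟩
  | add s t hs ht =>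
    obtain ⟨m, hm⟩ := hs
    obtain ⟨n, hn⟩ := ht
    exact ⟨max m n, by rw [map_add, pow_apply_eq_zero_of_le hm (le_max_left m n),
      pow_apply_eq_zero_of_le hn (le_max_right m n), add_zero]⟩
  | mul s t hs ht =>
    obtain ⟨m, hm⟩ := hs
    obtain ⟨n, hn⟩ := ht
    exact ⟨m + n, leibniz_pow_eq_zero (𝓐.ad_mul _) hm hn⟩

theorem ad_ofPoly_pow_comm (f g : 𝕊 k) (n : ℕ) (t : 𝓐.DiffAlg) :
    𝓐.ad (𝓐.ofPoly g) ((𝓐.ad (𝓐.ofPoly f) ^ n) t) =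
      (𝓐.ad (𝓐.ofPoly f) ^ n) (𝓐.ad (𝓐.ofPoly g) t) := by
  have h : Commute (𝓐.ad (𝓐.ofPoly g)) (𝓐.ad (𝓐.ofPoly f)) := by
    refine LinearMap.ext fun t => ?_
    have hfg : 𝓐.ofPoly f * 𝓐.ofPoly g = 𝓐.ofPoly g * 𝓐.ofPoly f := by
      rw [← map_mul, ← map_mul, mul_comm]
    simp only [Module.End.mul_apply, ad_apply, mul_sub, sub_mul, ← mul_assoc, hfg]
    simp only [mul_assoc, hfg]
    abel
  exact LinearMap.congr_fun (h.pow_right n) t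

/-- Passing to the last nonzero iterates of $\operatorname{ad}(f)$ replaces a pair of zero divisors
by a pair that commutes with $f$. -/
theorem exists_zero_divisors_ad_eq_zero [CharZero k] (f : 𝕊 k) {s t : 𝓐.DiffAlg} (hs : s ≠ 0)
    (ht : t ≠ 0) (hst : s * t = 0) :
    ∃ m n : ℕ, (𝓐.ad (𝓐.ofPoly f) ^ m) s ≠ 0 ∧ (𝓐.ad (𝓐.ofPoly f) ^ n) t ≠ 0 ∧
      𝓐.ad (𝓐.ofPoly f) ((𝓐.ad (𝓐.ofPoly f) ^ m) s) = 0 ∧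
      𝓐.ad (𝓐.ofPoly f) ((𝓐.ad (𝓐.ofPoly f) ^ n) t) = 0 ∧
      (𝓐.ad (𝓐.ofPoly f) ^ m) s * (𝓐.ad (𝓐.ofPoly f) ^ n) t = 0 := by
  obtain ⟨m, hm, hm'⟩ := exists_pow_ne_zero hs (𝓐.isLocallyAdNilpotent_ofPoly f s)
  obtain ⟨n, hn, hn'⟩ := exists_pow_ne_zero ht (𝓐.isLocallyAdNilpotent_ofPoly f t)
  have h := leibniz_pow_top (𝓐.ad_mul (𝓐.ofPoly f)) hm' hn'
  rw [hst, map_zero, eq_comm, ← Nat.cast_smul_eq_nsmul k] at h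
  refine ⟨m, n, hm, hn, by rwa [← Module.End.mul_apply, ← pow_succ'],
    by rwa [← Module.End.mul_apply, ← pow_succ'], ?_⟩
  refine (smul_eq_zero.1 h).resolve_left ?_
  exact Nat.cast_ne_zero.2 (Nat.choose_pos (Nat.le_add_right m n)).ne'

theorem eq_ofPoly_of_ad_eq_zero {t : 𝓐.DiffAlg} (h₀ : 𝓐.ad (𝓐.ofPoly (X 0)) t = 0)
    (h₁ : 𝓐.ad (𝓐.ofPoly (X 1)) t = 0) : t = 𝓐.ofPoly (𝓐.toEnd t 1) := by
  refine 𝓐.eq_ofPoly_of_commute fun i => ?_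
  fin_cases i
  · exact (sub_eq_zero.1 h₀).symm
  · exact (sub_eq_zero.1 h₁).symm

/-- The reduction is made for $x$ and then for $y$. Since $\operatorname{ad}(x)$ and
$\operatorname{ad}(y)$ commute, the second reduction keeps what the first achieved; the resulting
pair commutes with $S$, hence lies in the domain $S$. -/
instance [CharZero k] : NoZeroDivisors 𝓐.DiffAlg where
  eq_zero_or_eq_zero_of_mul_eq_zero {s t} hst := by
    by_contra! hne
    obtain ⟨m, n, hs, ht, hs', ht', h⟩ := 𝓐.exists_zero_divisors_ad_eq_zero (X 0) hne.1 hne.2 hst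
    obtain ⟨m', n', hs₂, ht₂, hs₂', ht₂', h₂⟩ := 𝓐.exists_zero_divisors_ad_eq_zero (X 1) hs ht h
    rw [𝓐.eq_ofPoly_of_ad_eq_zero (by rw [ad_ofPoly_pow_comm, hs', map_zero]) hs₂'] at h₂ hs₂
    rw [𝓐.eq_ofPoly_of_ad_eq_zero (by rw [ad_ofPoly_pow_comm, ht', map_zero]) ht₂'] at h₂ ht₂
    rw [← map_mul, map_eq_zero_iff _ 𝓐.ofPoly_injective] at h₂
    rcases mul_eq_zero.1 h₂ with h₂ | h₂
    · exact hs₂ (by rw [h₂, map_zero])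
    · exact ht₂ (by rw [h₂, map_zero])

/-- An element `p` is normal if `A p ⊆ p A`. -/
def IsNormalElement (p : 𝓐.DiffAlg) : Prop := ∀ t, ∃ s, t * p = p * s

theorem isNormalElement_ofPoly {p : 𝕊 k} (hE : p ∣ eulerDerivation k p)
    (hD : p ∣ 𝓐.verticalDerivation p) : 𝓐.IsNormalElement (𝓐.ofPoly p) := by
  intro t
  induction t using 𝓐.induction_on with
  | poly g => exact ⟨𝓐.ofPoly g, by rw [← map_mul, ← map_mul, mul_comm]⟩
  | hE =>
    obtain ⟨q, hq⟩ := hE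
    exact ⟨𝓐.E + 𝓐.ofPoly q, by rw [E_mul_ofPoly, hq, map_mul, mul_add]⟩
  | hD =>
    obtain ⟨q, hq⟩ := hD
    exact ⟨𝓐.D + 𝓐.ofPoly q, by rw [D_mul_ofPoly, hq, map_mul, mul_add]⟩
  | add s t hs ht =>
    obtain ⟨s', hs⟩ := hs
    obtain ⟨t', ht⟩ := ht
    exact ⟨s' + t', by rw [add_mul, hs, ht, mul_add]⟩
  | mul s t hs ht =>
    obtain ⟨s', hs⟩ := hs
    obtain ⟨t', ht⟩ := ht
    exact ⟨s' * t', by rw [mul_assoc, ht, ← mul_assoc, hs, mul_assoc]⟩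

theorem dvd_of_isNormalElement {p : 𝕊 k} (h : 𝓐.IsNormalElement (𝓐.ofPoly p)) (t : 𝓐.DiffAlg) :
    p ∣ 𝓐.toEnd t p := by
  obtain ⟨s, hs⟩ := h t
  have h' := congrArg (fun t => 𝓐.toEnd t 1) hs
  simp only [map_mul, Module.End.mul_apply, toEnd_ofPoly, mul_one] at h'
  exact ⟨_, h'⟩

theorem isNormalElement_of_irreducible_of_dvd_Q {p : 𝕊 k} (hp : Irreducible p) (h : p ∣ 𝓐.Q) :
    𝓐.IsNormalElement (𝓐.ofPoly p) := by
  obtain ⟨a, b, hab⟩ := 𝓐.exists_eq_of_dvd_Q hp h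
  have hhom : p.IsHomogeneous 1 := by
    rw [hab]
    exact (isHomogeneous_C_mul_X a 0).add (isHomogeneous_C_mul_X b 1)
  refine 𝓐.isNormalElement_ofPoly ⟨1, ?_⟩ ?_
  · rw [euler_of_isHomogeneous hhom]
    simp
  · rw [verticalDerivation_apply]
    rcases hp.prime.dvd_or_dvd h with h | h
    · obtain ⟨u, hu⟩ := h
      have hass : Associated p (X 0 : 𝕊 k) := hp.associated_of_dvd X_prime.irreducible ⟨u, hu⟩
      obtain ⟨v, hv⟩ := hass.symm
      obtain ⟨c, -, hcv⟩ := (isUnit_iff_eq_C_of_isReduced).1 v.isUnit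
      rw [hcv] at hv
      have : pderiv 1 p = 0 := by rw [← hv]; simp [pderiv_X]
      rw [this, mul_zero]
      exact dvd_zero p
    · exact h.mul_right _

/-- Evaluating $D$ and $E$ at $p$ gives $p\mid F\,\partial_yp$ and $p\mid E(p)$, whence $p\mid
Q\,\partial_xp$. If $p\nmid Q$, then $p$ divides both of its partial derivatives, so they vanish and
$p$ is constant. -/
theorem irreducible_dvd_Q_of_isNormalElement [CharZero k] {p : 𝕊 k} (hp : Irreducible p)
    (h : 𝓐.IsNormalElement (𝓐.ofPoly p)) : p ∣ 𝓐.Q := by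
  by_contra hQ
  have h₁ : p ∣ 𝓐.F * pderiv 1 p := 𝓐.dvd_of_isNormalElement h 𝓐.D
  have h₂ : p ∣ X 0 * pderiv 0 p + X 1 * pderiv 1 p := 𝓐.dvd_of_isNormalElement h 𝓐.E
  have h₃ : p ∣ 𝓐.Q * pderiv 0 p := by
    have h₄ := dvd_sub (h₂.mul_left 𝓐.F) (h₁.mul_left (X 1))
    convert h₄ using 1
    rw [Q]
    ring
  have hy := pderiv_eq_zero_of_dvd
    ((hp.prime.dvd_or_dvd h₁).resolve_left fun h => hQ (h.trans 𝓐.F_dvd_Q))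
  have hx := pderiv_eq_zero_of_dvd ((hp.prime.dvd_or_dvd h₃).resolve_left hQ)
  have hC := eq_C_of_pderiv_eq_zero (p := p) fun i => by fin_cases i <;> assumption
  refine hp.not_isUnit ?_
  have h0 : coeff 0 p ≠ 0 := fun h0 => hp.ne_zero (by rw [hC, h0, C_0])
  rw [hC]
  exact (isUnit_iff_ne_zero.2 h0).map C

theorem ad_eq_zero_of_isNormalElement [CharZero k] {u p : 𝓐.DiffAlg}
    (hu : 𝓐.IsLocallyAdNilpotent u) (hp : 𝓐.IsNormalElement p) : 𝓐.ad u p = 0 := by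
  obtain ⟨s, hs⟩ := hp u
  exact apply_eq_zero_of_eq_mul (𝓐.ad_mul u) hu (t := s - u)
    (by rw [ad_apply, hs, mul_sub])

/-- The locally ad-nilpotent elements are the polynomials. -/
theorem exists_eq_ofPoly_of_isLocallyAdNilpotent [CharZero k] {u : 𝓐.DiffAlg}
    (hu : 𝓐.IsLocallyAdNilpotent u) : ∃ f, u = 𝓐.ofPoly f := by
  -- A factor of $F$ supplies a second line $ax+by$ with $b\ne0$, so commuting with it and with $x$
  -- means commuting with $y$.
  obtain ⟨p, hp, hpF⟩ := 𝓐.exists_irreducible_dvd_F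
  obtain ⟨a, b, hb, hab⟩ := 𝓐.exists_eq_of_dvd_F hp hpF
  have h₀ := 𝓐.ad_eq_zero_of_isNormalElement hu
    (𝓐.isNormalElement_of_irreducible_of_dvd_Q X_prime.irreducible 𝓐.X_dvd_Q)
  have h₁ := 𝓐.ad_eq_zero_of_isNormalElement hu
    (𝓐.isNormalElement_of_irreducible_of_dvd_Q hp (hpF.trans 𝓐.F_dvd_Q))
  rw [hab, map_add, map_add, ← smul_eq_C_mul, ← smul_eq_C_mul, map_smul, map_smul, map_smul,
    map_smul, h₀, smul_zero, zero_add] at h₁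
  have h₂ := (smul_eq_zero.1 h₁).resolve_left hb
  refine ⟨_, 𝓐.eq_ofPoly_of_commute fun i => ?_⟩
  fin_cases i
  · exact sub_eq_zero.1 h₀
  · exact sub_eq_zero.1 h₂

end LineArrangement

/-! ### Normally ordered expressions and automorphisms that fix $S$. -/

section NormalForms

variable {k : Type*} [Field k] {B : Type*} [Ring B] [Algebra k B]

/-- The additive map `∑ s_{ij} ↦ ∑ s_{ij} D^i E^j`. -/
def normalForm (ι : 𝕊 k →ₐ[k] B) (E D : B) : (ℕ × ℕ →₀ 𝕊 k) →+ B :=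
  Finsupp.liftAddHom fun p => (AddMonoidHom.mulRight (D ^ p.1 * E ^ p.2)).comp (ι : 𝕊 k →+ B)

theorem normalForm_single (ι : 𝕊 k →ₐ[k] B) (E D : B) (i j : ℕ) (s : 𝕊 k) :
    normalForm ι E D (Finsupp.single (i, j) s) = ι s * (D ^ i * E ^ j) := by
  simp [normalForm]

theorem normalForm_map {B' : Type*} [Ring B'] [Algebra k B'] (f : B →ₐ[k] B') (ι : 𝕊 k →ₐ[k] B)
    (E D : B) (p : ℕ × ℕ →₀ 𝕊 k) :
    f (normalForm ι E D p) = normalForm (f.comp ι) (f E) (f D) p := by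
  induction p using Finsupp.induction_linear with
  | zero => simp
  | add p q hp hq => rw [map_add, map_add, map_add, hp, hq]
  | single ij s =>
    obtain ⟨i, j⟩ := ij
    simp only [normalForm_single, map_mul, map_pow, AlgHom.comp_apply]

theorem mul_pow_of_mul_eq {E D : B} {r : ℕ} (h : E * D = D * E + (r : B) * D) (i : ℕ) :
    E * D ^ i = D ^ i * E + ((i * r : ℕ) : B) * D ^ i := by
  induction i with
  | zero => simp
  | succ i ih =>
    have hc : Commute (((i * r : ℕ) : B)) (D ^ i) := Nat.cast_commute _ _
    rw [pow_succ, ← mul_assoc, ih, add_mul, mul_assoc, h, mul_add, ← mul_assoc (D ^ i) (r : B),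
      ← (Nat.cast_commute r (D ^ i)).eq, mul_assoc, mul_assoc, mul_assoc, add_assoc, ← add_mul]
    congr 2
    push_cast
    noncomm_ring

/-- Under the commutation relations of `E`, `D` and polynomials, the normally ordered expressions
exhaust the algebra generated by them. -/
theorem exists_normalForm_of_mem_adjoin {ι : 𝕊 k →ₐ[k] B} {E D : B} {ε δ : 𝕊 k → 𝕊 k} {r : ℕ}
    (hE : ∀ s, E * ι s = ι s * E + ι (ε s)) (hD : ∀ s, D * ι s = ι s * D + ι (δ s))
    (hED : E * D = D * E + (r : B) * D) {b : B}
    (hb : b ∈ Algebra.adjoin k (Set.range ι ∪ {E, D})) : ∃ p, normalForm ι E D p = b := by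
  -- The ordered expressions contain $1$, so it is enough that they are stable under left
  -- multiplication by the generators.
  have key : ∀ b ∈ Algebra.adjoin k (Set.range ι ∪ {E, D}),
      ∀ m ∈ (normalForm ι E D).range, b * m ∈ (normalForm ι E D).range := by
    have hgen : ∀ b, (∀ i j s, b * (ι s * (D ^ i * E ^ j)) ∈ (normalForm ι E D).range) →
        ∀ m ∈ (normalForm ι E D).range, b * m ∈ (normalForm ι E D).range := by
      rintro b hb - ⟨p, rfl⟩
      induction p using Finsupp.induction_linear with
      | zero => simp
      | add p q hp hq => rw [map_add, mul_add]; exact add_mem hp hq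
      | single ij s => rw [normalForm_single]; exact hb _ _ _
    have hmem : ∀ i j s, ι s * (D ^ i * E ^ j) ∈ (normalForm ι E D).range :=
      fun i j s => ⟨_, normalForm_single ι E D i j s⟩
    intro b hb
    induction hb using Algebra.adjoin_induction with
    | mem b hb =>
      apply hgen
      intro i j s
      rcases hb with ⟨f, rfl⟩ | rfl | rfl
      · rw [← mul_assoc, ← map_mul]
        exact hmem _ _ _
      · have h : b * (ι s * (D ^ i * b ^ j)) = ι s * (D ^ i * b ^ (j + 1)) +
            ι (((i * r : ℕ) : 𝕊 k) * s) * (D ^ i * b ^ j) + ι (ε s) * (D ^ i * b ^ j) := by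
          rw [← mul_assoc, hE, add_mul, mul_assoc, ← mul_assoc b, mul_pow_of_mul_eq hED, add_mul,
            mul_add, mul_assoc (D ^ i), ← pow_succ', map_mul, map_natCast,
            (Nat.cast_commute (i * r) (ι s)).eq]
          simp only [mul_assoc]
        rw [h]
        exact add_mem (add_mem (hmem _ _ _) (hmem _ _ _)) (hmem _ _ _)
      · have h : b * (ι s * (b ^ i * E ^ j)) = ι s * (b ^ (i + 1) * E ^ j) +
            ι (δ s) * (b ^ i * E ^ j) := by
          rw [← mul_assoc, hD, add_mul, mul_assoc, ← mul_assoc b, ← pow_succ']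
        rw [h]
        exact add_mem (hmem _ _ _) (hmem _ _ _)
    | algebraMap c =>
      apply hgen
      intro i j s
      rw [← mul_assoc, ← ι.commutes, ← map_mul]
      exact hmem _ _ _
    | add a b _ _ ha hb =>
      intro m hm
      rw [add_mul]
      exact add_mem (ha m hm) (hb m hm)
    | mul a b _ _ ha hb =>
      intro m hm
      rw [mul_assoc]
      exact ha _ (hb m hm)
  have h1 : (1 : B) ∈ (normalForm ι E D).range :=
    ⟨Finsupp.single (0, 0) 1, by rw [normalForm_single]; simp⟩
  simpa using key b hb 1 h1

theorem normalForm_eq_sum (ι : 𝕊 k →ₐ[k] B) (E D : B) (p : ℕ × ℕ →₀ 𝕊 k) {n : ℕ}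
    (hn : p.support ⊆ Finset.range n ×ˢ Finset.range n) :
    normalForm ι E D p = ∑ j ∈ Finset.range n,
      (∑ i ∈ Finset.range n, ι (p (i, j)) * D ^ i) * E ^ j := by
  have h : normalForm ι E D p = p.sum fun ij s => ι s * (D ^ ij.1 * E ^ ij.2) := rfl
  rw [h, Finsupp.sum_of_support_subset p hn _ fun ij _ => by rw [map_zero, zero_mul],
    Finset.sum_product_right]
  refine Finset.sum_congr rfl fun j _ => ?_
  rw [Finset.sum_mul]
  exact Finset.sum_congr rfl fun i _ => (mul_assoc _ _ _).symm

end NormalForms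

namespace LineArrangement

open PlanePoly

variable {k : Type*} [Field k] {r : ℕ} (𝓐 : LineArrangement k r)

/-- Normally ordered expressions are linearly independent over `S`. -/
theorem normalForm_injective [CharZero k] {E' D' : 𝓐.DiffAlg}
    (hE : ∀ s, E' * 𝓐.ofPoly s = 𝓐.ofPoly s * E' + 𝓐.ofPoly (eulerDerivation k s))
    (hD : ∀ s, D' * 𝓐.ofPoly s = 𝓐.ofPoly s * D' + 𝓐.ofPoly (𝓐.verticalDerivation s)) :
    Function.Injective (normalForm 𝓐.ofPoly E' D') := by
  refine (injective_iff_map_eq_zero _).2 fun p hp => ?_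
  set n := p.support.sup (fun q => q.1 + q.2) + 1 with hn
  have hle : ∀ q ∈ p.support, q.1 + q.2 < n := fun q hq =>
    Nat.lt_succ_of_le (Finset.le_sup (f := fun q : ℕ × ℕ => q.1 + q.2) hq)
  have hsub : p.support ⊆ Finset.range n ×ˢ Finset.range n := fun q hq => by
    have := hle q hq
    simp only [Finset.mem_product, Finset.mem_range]
    omega
  rw [normalForm_eq_sum _ _ _ p hsub] at hp
  have hadE : ∀ f, 𝓐.ad (𝓐.ofPoly f) E' = -𝓐.ofPoly (eulerDerivation k f) := fun f => by
    rw [ad_apply, hE]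
    abel
  have hadD : ∀ f, 𝓐.ad (𝓐.ofPoly f) D' = -𝓐.ofPoly (𝓐.verticalDerivation f) := fun f => by
    rw [ad_apply, hD]
    abel
  have hX : eulerDerivation k (X 0) = X 0 := by simp [eulerDerivation_apply, pderiv_X]
  have hX' : 𝓐.verticalDerivation (X 0) = 0 := by simp [verticalDerivation_apply, pderiv_X]
  have hY : 𝓐.verticalDerivation (X 1) = 𝓐.F := by simp [verticalDerivation_apply]
  have hne : ∀ f : 𝕊 k, f ≠ 0 → -𝓐.ofPoly f ≠ 0 := fun f hf =>
    neg_ne_zero.2 ((map_ne_zero_iff _ 𝓐.ofPoly_injective).2 hf)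
  have hpow : ∀ i, 𝓐.ad (𝓐.ofPoly (X 0)) (D' ^ i) = 0 := by
    intro i
    have hcomm : Commute (𝓐.ofPoly (X 0)) D' := by
      have := hadD (X 0)
      rw [hX', map_zero, neg_zero] at this
      exact sub_eq_zero.1 this
    exact sub_eq_zero.2 (hcomm.pow_right i)
  -- $\operatorname{ad}(x)$ kills $S$ and $D'$ and sends $E'$ to $-x$: this separates the powers of
  -- $E'$.
  have hrow := eq_zero_of_sum_mul_pow_eq_zero (𝓐.ad_mul (𝓐.ofPoly (X 0))) (T := E')
    (by rw [hadE, hX]; exact hne _ (X_ne_zero 0))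
    (by rw [hadE, map_neg, ad_ofPoly_ofPoly, neg_zero])
    (fun j => by
      rw [map_sum]
      exact Finset.sum_eq_zero fun i _ => by
        rw [ad_mul, ad_ofPoly_ofPoly, zero_mul, zero_add, hpow, mul_zero]) hp
  ext1 ⟨i, j⟩
  by_contra hij
  have hlt := hle (i, j) (Finsupp.mem_support_iff.2 hij)
  -- $\operatorname{ad}(y)$ kills $S$ and sends $D'$ to $-F$: this separates the powers of $D'$.
  have hcoeff := eq_zero_of_sum_mul_pow_eq_zero (𝓐.ad_mul (𝓐.ofPoly (X 1))) (T := D')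
    (by rw [hadD, hY]; exact hne _ 𝓐.F_ne_zero)
    (by rw [hadD, map_neg, ad_ofPoly_ofPoly, neg_zero])
    (fun i => 𝓐.ad_ofPoly_ofPoly (X 1) (p (i, j))) (hrow j (by omega)) i (by omega)
  exact hij ((map_eq_zero_iff _ 𝓐.ofPoly_injective).1 hcoeff)

/-- The automorphisms that fix `S` and add polynomials to `E` and `D`. -/
theorem exists_shift [CharZero k] {ε φ : 𝕊 k}
    (h : eulerDerivation k φ = 𝓐.verticalDerivation ε + (r : 𝕊 k) * φ) :
    ∃ θ : 𝓐.DiffAlg ≃ₐ[k] 𝓐.DiffAlg, (∀ f, θ (𝓐.ofPoly f) = 𝓐.ofPoly f) ∧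
      θ 𝓐.E = 𝓐.E + 𝓐.ofPoly ε ∧ θ 𝓐.D = 𝓐.D + 𝓐.ofPoly φ := by
  set E' := 𝓐.E + 𝓐.ofPoly ε with hE'
  set D' := 𝓐.D + 𝓐.ofPoly φ with hD'
  have hcomm : ∀ f g, 𝓐.ofPoly f * 𝓐.ofPoly g = 𝓐.ofPoly g * 𝓐.ofPoly f := fun f g => by
    rw [← map_mul, ← map_mul, mul_comm]
  have hE : ∀ s, E' * 𝓐.ofPoly s = 𝓐.ofPoly s * E' + 𝓐.ofPoly (eulerDerivation k s) := fun s => by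
    rw [hE', add_mul, E_mul_ofPoly, mul_add, hcomm ε s]
    abel
  have hD : ∀ s, D' * 𝓐.ofPoly s = 𝓐.ofPoly s * D' + 𝓐.ofPoly (𝓐.verticalDerivation s) :=
    fun s => by
      rw [hD', add_mul, D_mul_ofPoly, mul_add, hcomm φ s]
      abel
  -- The hypothesis on $\varepsilon$ and $\varphi$ says precisely that $[E',D']=rD'$.
  have hED : E' * D' = D' * E' + (r : 𝓐.DiffAlg) * D' := by
    have hr : (r : 𝓐.DiffAlg) = 𝓐.ofPoly (r : 𝕊 k) := by simp
    rw [hE', hD', add_mul, mul_add, mul_add, E_mul_D, E_mul_ofPoly, h, mul_add, add_mul, add_mul,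
      mul_add, D_mul_ofPoly, hcomm ε φ, hr, map_add, map_mul]
    abel
  -- The automorphism is built as its graph $G\subseteq A\times A$. Every element of $G$ has a
  -- normally ordered form, and such forms are independent in either coordinate, so both projections
  -- are injective; they are onto because their images contain the generators.
  set ι : 𝕊 k →ₐ[k] 𝓐.DiffAlg × 𝓐.DiffAlg := 𝓐.ofPoly.prod 𝓐.ofPoly with hι
  set G := Algebra.adjoin k (Set.range ι ∪ {(𝓐.E, E'), (𝓐.D, D')}) with hG
  have hnf : ∀ g : G, ∃ p, normalForm ι (𝓐.E, E') (𝓐.D, D') p = g := fun g =>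
    exists_normalForm_of_mem_adjoin (ε := eulerDerivation k) (δ := 𝓐.verticalDerivation) (r := r)
      (fun s => Prod.ext (𝓐.E_mul_ofPoly s) (hE s)) (fun s => Prod.ext (𝓐.D_mul_ofPoly s) (hD s))
      (Prod.ext 𝓐.E_mul_D hED) g.2
  have hιG : ∀ f, ι f ∈ G := fun f => Algebra.subset_adjoin (Or.inl ⟨f, rfl⟩)
  have hEG : ((𝓐.E, E') : 𝓐.DiffAlg × 𝓐.DiffAlg) ∈ G :=
    Algebra.subset_adjoin (Or.inr (Or.inl rfl))
  have hDG : ((𝓐.D, D') : 𝓐.DiffAlg × 𝓐.DiffAlg) ∈ G :=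
    Algebra.subset_adjoin (Or.inr (Or.inr rfl))
  set p₁ : G →ₐ[k] 𝓐.DiffAlg := (AlgHom.fst k _ _).comp G.val with hp₁
  set p₂ : G →ₐ[k] 𝓐.DiffAlg := (AlgHom.snd k _ _).comp G.val with hp₂
  have hinj : ∀ q : 𝓐.DiffAlg × 𝓐.DiffAlg →ₐ[k] 𝓐.DiffAlg, q.comp ι = 𝓐.ofPoly →
      (∀ s, q (𝓐.E, E') * 𝓐.ofPoly s =
        𝓐.ofPoly s * q (𝓐.E, E') + 𝓐.ofPoly (eulerDerivation k s)) →
      (∀ s, q (𝓐.D, D') * 𝓐.ofPoly s =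
        𝓐.ofPoly s * q (𝓐.D, D') + 𝓐.ofPoly (𝓐.verticalDerivation s)) →
      Function.Injective (q.comp G.val) := by
    intro q hq hqE hqD
    refine (injective_iff_map_eq_zero _).2 fun g hg => ?_
    obtain ⟨p, hp⟩ := hnf g
    rw [AlgHom.comp_apply, Subalgebra.coe_val, ← hp, normalForm_map, hq] at hg
    have hp0 : p = 0 := 𝓐.normalForm_injective hqE hqD (by rw [hg, map_zero])
    exact Subtype.ext (by rw [← hp, hp0, map_zero]; rfl)
  have hsurj : ∀ q : G →ₐ[k] 𝓐.DiffAlg, (∀ f, 𝓐.ofPoly f ∈ q.range) → 𝓐.E ∈ q.range →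
      𝓐.D ∈ q.range → Function.Surjective q := by
    intro q hq hqE hqD t
    change t ∈ q.range
    induction t using 𝓐.induction_on with
    | poly f => exact hq f
    | hE => exact hqE
    | hD => exact hqD
    | add s t hs ht => exact add_mem hs ht
    | mul s t hs ht => exact mul_mem hs ht
  have hb₁ : Function.Bijective p₁ :=
    ⟨hinj _ (AlgHom.ext fun _ => rfl) 𝓐.E_mul_ofPoly 𝓐.D_mul_ofPoly,
      hsurj _ (fun f => ⟨⟨_, hιG f⟩, rfl⟩) ⟨⟨_, hEG⟩, rfl⟩ ⟨⟨_, hDG⟩, rfl⟩⟩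
  have hpoly₂ : ∀ f, 𝓐.ofPoly f ∈ p₂.range := fun f => ⟨⟨_, hιG f⟩, rfl⟩
  have hb₂ : Function.Bijective p₂ := by
    refine ⟨hinj _ (AlgHom.ext fun _ => rfl) hE hD, hsurj _ hpoly₂ ?_ ?_⟩
    · have hE₂ : E' ∈ p₂.range := ⟨⟨_, hEG⟩, rfl⟩
      simpa [hE'] using sub_mem hE₂ (hpoly₂ ε)
    · have hD₂ : D' ∈ p₂.range := ⟨⟨_, hDG⟩, rfl⟩
      simpa [hD'] using sub_mem hD₂ (hpoly₂ φ)
  have hθ : ∀ g : G, ((AlgEquiv.ofBijective p₁ hb₁).symm.trans (AlgEquiv.ofBijective p₂ hb₂))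
      (p₁ g) = p₂ g := by
    intro g
    rw [AlgEquiv.trans_apply, ← AlgEquiv.ofBijective_apply (hf := hb₁), AlgEquiv.symm_apply_apply,
      AlgEquiv.ofBijective_apply]
  exact ⟨_, fun f => hθ ⟨_, hιG f⟩, hθ ⟨_, hEG⟩, hθ ⟨_, hDG⟩⟩

end LineArrangement

/-! ### Automorphisms induced by linear substitutions. -/

namespace LineArrangement

open PlanePoly

variable {k : Type*} [Field k] {r : ℕ} (𝓐 : LineArrangement k r)

theorem preservesQ_iff {a b c d e : k} : 𝓐.PreservesQ a b c d e ↔ a * d - b * c ≠ 0 ∧ e ≠ 0 ∧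
    subst a b c d 𝓐.Q = C ((a * d - b * c) * e) * 𝓐.Q := by
  refine and_congr_right fun hΔ => and_congr_right fun he => ?_
  have h0 : (a * d - b * c) * e ≠ 0 := mul_ne_zero hΔ he
  change C (((a * d - b * c) * e)⁻¹) * subst a b c d 𝓐.Q = 𝓐.Q ↔ _
  constructor
  · intro h
    conv_rhs => rw [← h]
    rw [← mul_assoc, ← C_mul, mul_inv_cancel₀ h0, C_1, one_mul]
  · intro h
    rw [h, ← mul_assoc, ← C_mul, inv_mul_cancel₀ h0, C_1, one_mul]

variable {𝓐}

theorem PreservesQ.det_ne_zero {a b c d e : k} (h : 𝓐.PreservesQ a b c d e) :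
    a * d - b * c ≠ 0 := h.1

theorem PreservesQ.ne_zero {a b c d e : k} (h : 𝓐.PreservesQ a b c d e) : e ≠ 0 := h.2.1

theorem PreservesQ.subst_Q {a b c d e : k} (h : 𝓐.PreservesQ a b c d e) :
    subst a b c d 𝓐.Q = C ((a * d - b * c) * e) * 𝓐.Q := (𝓐.preservesQ_iff.1 h).2.2

theorem PreservesQ.mul_subst_F {a b c d e : k} (h : 𝓐.PreservesQ a b c d e) :
    (C a * X 0 + C b * X 1) * subst a b c d 𝓐.F = C ((a * d - b * c) * e) * (X 0 * 𝓐.F) := by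
  have h' := h.subst_Q
  rwa [Q, map_mul, subst_X_zero] at h'

theorem PreservesQ.linear_ne_zero {a b c d e : k} (h : 𝓐.PreservesQ a b c d e) :
    (C a * X 0 + C b * X 1 : 𝕊 k) ≠ 0 := by
  intro h0
  have h' := h.mul_subst_F
  rw [h0, zero_mul, eq_comm] at h'
  exact mul_ne_zero (C_ne_zero.2 (mul_ne_zero h.det_ne_zero h.ne_zero)) 𝓐.Q_ne_zero h'

theorem PreservesQ.inv {a b c d e : k} (h : 𝓐.PreservesQ a b c d e) :
    𝓐.PreservesQ (d / (a * d - b * c)) (-b / (a * d - b * c)) (-c / (a * d - b * c))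
      (a / (a * d - b * c)) e⁻¹ := by
  have hΔ := h.det_ne_zero
  have he := h.ne_zero
  have hdet : d / (a * d - b * c) * (a / (a * d - b * c)) -
      -b / (a * d - b * c) * (-c / (a * d - b * c)) = (a * d - b * c)⁻¹ := by
    rw [div_mul_div_comm, div_mul_div_comm, ← sub_div, neg_mul_neg, mul_comm d a,
      div_mul_cancel_left₀ hΔ]
  rw [preservesQ_iff, hdet]
  refine ⟨inv_ne_zero hΔ, inv_ne_zero he, ?_⟩
  rw [← substEquiv_symm_apply a b c d hΔ, AlgEquiv.symm_apply_eq, substEquiv_apply, map_mul,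
    subst_C, h.subst_Q, ← mul_assoc, ← C_mul, ← mul_inv, inv_mul_cancel₀ (mul_ne_zero hΔ he), C_1,
    one_mul]

/-- The coefficient of `E` in the image of `D` under a standard automorphism. -/
theorem PreservesQ.exists_coeff {a b c d e : k} (h : 𝓐.PreservesQ a b c d e) :
    ∃ H : 𝕊 k, H * (C a * X 0 + C b * X 1) = C (e * b) * 𝓐.F := by
  rcases eq_or_ne b 0 with rfl | hb
  · exact ⟨0, by simp⟩
  have hirr : Irreducible (C a * X 0 + C b * X 1 : 𝕊 k) := by
    rw [← subst_X_zero a b c d, ← substEquiv_apply a b c d h.det_ne_zero]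
    exact (MulEquiv.irreducible_iff _).2 X_prime.irreducible
  have hdvd : (C a * X 0 + C b * X 1 : 𝕊 k) ∣ X 0 * 𝓐.F := by
    have h1 : (C a * X 0 + C b * X 1 : 𝕊 k) ∣ C ((a * d - b * c) * e) * (X 0 * 𝓐.F) :=
      ⟨_, h.mul_subst_F.symm⟩
    refine (hirr.prime.dvd_or_dvd h1).resolve_left fun h2 => hirr.not_isUnit ?_
    exact isUnit_of_dvd_unit h2
      ((isUnit_iff_ne_zero.2 (mul_ne_zero h.det_ne_zero h.ne_zero)).map C)
  -- The form $ax+by$ cannot divide $x$, because $b\ne0$; so it divides $F$.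
  rcases hirr.prime.dvd_or_dvd hdvd with hx | ⟨G, hG⟩
  · obtain ⟨u, hu⟩ := hirr.associated_of_dvd X_prime.irreducible hx
    obtain ⟨s, hs, hsu⟩ := (isUnit_iff_eq_C_of_isReduced).1 u.isUnit
    have h1 := congrArg (pderiv 1) hu
    rw [hsu] at h1
    simp [pderiv_X] at h1
    exact absurd h1 (not_or.2 ⟨hs.ne_zero, hb⟩)
  · exact ⟨C (e * b) * G, by rw [hG]; ring⟩

theorem isHomogeneous_coeff [CharZero k] {a b c d e : k} (h : 𝓐.PreservesQ a b c d e) {H : 𝕊 k}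
    (hH : H * (C a * X 0 + C b * X 1) = C (e * b) * 𝓐.F) : H.IsHomogeneous r := by
  refine isHomogeneous_of_euler (mul_right_cancel₀ h.linear_ne_zero ?_)
  have h1 : (C a * X 0 + C b * X 1 : 𝕊 k).IsHomogeneous 1 :=
    (isHomogeneous_C_mul_X a 0).add (isHomogeneous_C_mul_X b 1)
  have h2 : (C (e * b) * 𝓐.F).IsHomogeneous (r + 1) := 𝓐.homogeneous.C_mul _
  have h3 := euler_of_isHomogeneous h2
  rw [← hH, Derivation.leibniz, euler_of_isHomogeneous h1, smul_eq_mul, smul_eq_mul] at h3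
  push_cast at h3
  linear_combination h3

/-- The equation for $H$ absorbs the case distinction: its unique solution is $0$ if $b=0$ and
$ebF/(ax+by)$ otherwise. -/
theorem isStandard_iff {a b c d e v : k} (h : 𝓐.PreservesQ a b c d e) {H : 𝕊 k}
    (hH : H * (C a * X 0 + C b * X 1) = C (e * b) * 𝓐.F) {φ₀ : 𝕊 k}
    {θ : 𝓐.DiffAlg ≃ₐ[k] 𝓐.DiffAlg} : 𝓐.IsStandard a b c d e v φ₀ θ ↔
      θ (𝓐.ofPoly (X 0)) = 𝓐.ofPoly (C a * X 0 + C b * X 1) ∧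
      θ (𝓐.ofPoly (X 1)) = 𝓐.ofPoly (C c * X 0 + C d * X 1) ∧
      θ 𝓐.E = 𝓐.E + algebraMap k 𝓐.DiffAlg v ∧
      θ 𝓐.D = 𝓐.ofPoly φ₀ - 𝓐.ofPoly H * 𝓐.E + e • 𝓐.D := by
  have huniq : ∀ H', H' * (C a * X 0 + C b * X 1) = C (e * b) * 𝓐.F → H' = H := fun H' hH' =>
    mul_right_cancel₀ h.linear_ne_zero (hH'.trans hH.symm)
  constructor
  · rintro ⟨hx, hy, hE, hb, hb0⟩
    refine ⟨hx, hy, hE, ?_⟩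
    rcases eq_or_ne b 0 with rfl | hne
    · rw [hb0 rfl, ← huniq 0 (by simp), map_zero, zero_mul, sub_zero]
    · obtain ⟨G, hG, hD⟩ := hb hne
      rw [hD, huniq (C (e * b) * G) (by rw [← hG]; ring)]
  · rintro ⟨hx, hy, hE, hD⟩
    refine ⟨hx, hy, hE, fun hb => ⟨C (e * b)⁻¹ * H, ?_, ?_⟩, ?_⟩
    · have hC : (C (e * b)⁻¹ * C (e * b) : 𝕊 k) = 1 := by
        rw [← C_mul, inv_mul_cancel₀ (mul_ne_zero h.ne_zero hb), C_1]
      linear_combination C (e * b)⁻¹ * hH + 𝓐.F * hC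
    · rw [hD, ← mul_assoc, ← C_mul, mul_inv_cancel₀ (mul_ne_zero h.ne_zero hb), C_1, one_mul]
    · rintro rfl
      rw [hD, ← huniq 0 (by simp), map_zero, zero_mul, sub_zero]

/-- Compatibility of `e D - H E` with `D` under the substitution. -/
theorem PreservesQ.subst_vertical {a b c d e : k} (h : 𝓐.PreservesQ a b c d e) {H : 𝕊 k}
    (hH : H * (C a * X 0 + C b * X 1) = C (e * b) * 𝓐.F) (f : 𝕊 k) :
    C e * 𝓐.verticalDerivation (subst a b c d f) - H * eulerDerivation k (subst a b c d f) =
      subst a b c d (𝓐.verticalDerivation f) := by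
  have hD : ∀ u w : k, 𝓐.verticalDerivation (C u * X 0 + C w * X 1) = C w * 𝓐.F := fun u w => by
    simp [verticalDerivation_apply, pderiv_X, mul_comm]
  have hE : ∀ u w : k, eulerDerivation k (C u * X 0 + C w * X 1) = C u * X 0 + C w * X 1 :=
    fun u w => by
      simp [eulerDerivation_apply, pderiv_X, mul_comm]
  induction f using MvPolynomial.induction_on with
  | C s => simp
  | add p q hp hq => simp only [map_add, ← hp, ← hq]; ring
  | mul_X p i hp =>
    have hX : C e * 𝓐.verticalDerivation (subst a b c d (X i)) -
        H * eulerDerivation k (subst a b c d (X i)) =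
          subst a b c d (𝓐.verticalDerivation (X i)) := by
      fin_cases i
      · change C e * 𝓐.verticalDerivation (subst a b c d (X 0)) -
          H * eulerDerivation k (subst a b c d (X 0)) = subst a b c d (𝓐.verticalDerivation (X 0))
        rw [subst_X_zero, hD, hE, hH, show 𝓐.verticalDerivation (X 0) = 0 by
          simp [verticalDerivation_apply, pderiv_X], map_zero, C_mul]
        ring
      · change C e * 𝓐.verticalDerivation (subst a b c d (X 1)) -
          H * eulerDerivation k (subst a b c d (X 1)) = subst a b c d (𝓐.verticalDerivation (X 1))
        rw [subst_X_one, hD, hE, show 𝓐.verticalDerivation (X 1) = 𝓐.F by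
          simp [verticalDerivation_apply]]
        -- After multiplication by $ax+by$ the claim is
        -- $eF\bigl(d(ax+by)-b(cx+dy)\bigr)=(ad-bc)e\,xF$.
        refine mul_left_cancel₀ h.linear_ne_zero ?_
        rw [h.mul_subst_F]
        simp only [C_mul, C_sub] at hH ⊢
        linear_combination -(C c * X 0 + C d * X 1) * hH
    simp only [map_mul, Derivation.leibniz, smul_eq_mul, map_add, ← hp, ← hX]
    ring

/-- The operator $t'$ is $\sigma t\sigma^{-1}$ for the substitution $\sigma$. That it lies in $A$
needs checking on generators only, and $\sigma D\sigma^{-1}=eD-HE$. -/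
theorem PreservesQ.exists_conj_apply {a b c d e : k} (h : 𝓐.PreservesQ a b c d e)
    (t : 𝓐.DiffAlg) :
    ∃ t' : 𝓐.DiffAlg, ∀ f, 𝓐.toEnd t' (subst a b c d f) = subst a b c d (𝓐.toEnd t f) := by
  obtain ⟨H, hH⟩ := h.exists_coeff
  induction t using 𝓐.induction_on with
  | poly g => exact ⟨𝓐.ofPoly (subst a b c d g), fun f => by simp only [toEnd_ofPoly, map_mul]⟩
  | hE => exact ⟨𝓐.E, fun f => by simp only [toEnd_E, euler_subst]⟩
  | hD =>
    refine ⟨𝓐.ofPoly (C e) * 𝓐.D - 𝓐.ofPoly H * 𝓐.E, fun f => ?_⟩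
    rw [toEnd_D, ← h.subst_vertical hH]
    rfl
  | add s t hs ht =>
    obtain ⟨s', hs⟩ := hs
    obtain ⟨t', ht⟩ := ht
    exact ⟨s' + t', fun f => by simp only [map_add, LinearMap.add_apply, hs, ht]⟩
  | mul s t hs ht =>
    obtain ⟨s', hs⟩ := hs
    obtain ⟨t', ht⟩ := ht
    exact ⟨s' * t', fun f => by simp only [map_mul, Module.End.mul_apply, hs, ht]⟩

/-- Conjugation by a linear substitution that preserves the arrangement. -/
theorem PreservesQ.exists_conj {a b c d e : k} (h : 𝓐.PreservesQ a b c d e) {H : 𝕊 k}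
    (hH : H * (C a * X 0 + C b * X 1) = C (e * b) * 𝓐.F) :
    ∃ θ : 𝓐.DiffAlg ≃ₐ[k] 𝓐.DiffAlg, (∀ f, θ (𝓐.ofPoly f) = 𝓐.ofPoly (subst a b c d f)) ∧
      θ 𝓐.E = 𝓐.E ∧ θ 𝓐.D = e • 𝓐.D - 𝓐.ofPoly H * 𝓐.E := by
  have hΔ := h.det_ne_zero
  choose T hT using h.exists_conj_apply
  choose T' hT' using h.inv.exists_conj_apply
  have hσ : ∀ f, ∃ g, subst a b c d g = f := (substEquiv a b c d hΔ).surjective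
  have ext : ∀ {s t : 𝓐.DiffAlg}, (∀ f, 𝓐.toEnd s (subst a b c d f) =
      𝓐.toEnd t (subst a b c d f)) → s = t := fun h => 𝓐.toEnd_ext fun f => by
    obtain ⟨g, rfl⟩ := hσ f
    exact h g
  have hTT' : ∀ t, T (T' t) = t := fun t => ext fun f => by
    rw [hT]
    have h1 := hT' t (subst a b c d f)
    simp only [← substEquiv_symm_apply a b c d hΔ, ← substEquiv_apply a b c d hΔ,
      AlgEquiv.symm_apply_apply] at h1 ⊢
    rw [h1, AlgEquiv.apply_symm_apply]
  have hT'T : ∀ t, T' (T t) = t := fun t => 𝓐.toEnd_ext fun f => by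
    have h1 := hT' (T t) (subst a b c d f)
    rw [hT] at h1
    simpa only [← substEquiv_symm_apply a b c d hΔ, ← substEquiv_apply a b c d hΔ,
      AlgEquiv.symm_apply_apply] using h1
  refine ⟨{ toFun := T, invFun := T', left_inv := hT'T, right_inv := hTT',
            map_mul' := fun s t => ext fun f => ?_, map_add' := fun s t => ext fun f => ?_,
            commutes' := fun s => ext fun f => ?_ }, fun g => ext fun f => ?_, ext fun f => ?_,
            ext fun f => ?_⟩
  · simp only [map_mul, Module.End.mul_apply, hT]
  · simp only [map_add, LinearMap.add_apply, hT]
  · rw [hT, ← ofPoly_C, toEnd_ofPoly, toEnd_ofPoly, map_mul, subst_C]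
  · exact (hT _ f).trans (by simp only [toEnd_ofPoly, map_mul])
  · exact (hT _ f).trans (by simp only [toEnd_E, euler_subst])
  · refine (hT _ f).trans ?_
    rw [toEnd_D, ← h.subst_vertical hH, ← smul_eq_C_mul]
    rfl

/-- The composite sends $D$ to $e(D+\varphi)-H(E+v)$, hence the polynomial term $e\varphi-Hv$. -/
theorem isStandard_mul [CharZero k] {a b c d e v : k} (h : 𝓐.PreservesQ a b c d e) {H φ : 𝕊 k}
    (hH : H * (C a * X 0 + C b * X 1) = C (e * b) * 𝓐.F)
    {ψ θ : 𝓐.DiffAlg ≃ₐ[k] 𝓐.DiffAlg} (hψ : ∀ f, ψ (𝓐.ofPoly f) = 𝓐.ofPoly f)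
    (hψE : ψ 𝓐.E = 𝓐.E + 𝓐.ofPoly (C v)) (hψD : ψ 𝓐.D = 𝓐.D + 𝓐.ofPoly φ)
    (hθ : ∀ f, θ (𝓐.ofPoly f) = 𝓐.ofPoly (subst a b c d f)) (hθE : θ 𝓐.E = 𝓐.E)
    (hθD : θ 𝓐.D = e • 𝓐.D - 𝓐.ofPoly H * 𝓐.E) :
    𝓐.IsStandard a b c d e v (C e * φ - H * C v) (ψ * θ) := by
  rw [isStandard_iff h hH]
  simp only [AlgEquiv.mul_apply, hθ, hθE, hθD, hψ, hψE, subst_X_zero, subst_X_one, true_and,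
    ofPoly_C, map_sub, map_mul, map_smul, hψD, smul_add, mul_add]
  rw [← Algebra.smul_def]
  abel

theorem PreservesQ.existsUnique_isStandard [CharZero k] {a b c d e : k}
    (h : 𝓐.PreservesQ a b c d e) (v : k) {φ₀ : 𝕊 k} (hφ₀ : φ₀.IsHomogeneous r) :
    ∃! θ : 𝓐.DiffAlg ≃ₐ[k] 𝓐.DiffAlg, 𝓐.IsStandard a b c d e v φ₀ θ := by
  obtain ⟨H, hH⟩ := h.exists_coeff
  obtain ⟨θ, hθ, hθE, hθD⟩ := h.exists_conj hH
  -- The shift of $D$ is the solution of $e\varphi-vH=\varphi_0$. For constant $\varepsilon$ the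
  -- condition of `exists_shift` is $E(\varphi)=r\varphi$, that is, homogeneity of degree $r$.
  have hφ : (C e⁻¹ * (φ₀ + C v * H)).IsHomogeneous r :=
    (hφ₀.add ((isHomogeneous_coeff h hH).C_mul v)).C_mul _
  obtain ⟨ψ, hψ, hψE, hψD⟩ := 𝓐.exists_shift (ε := C v) (φ := C e⁻¹ * (φ₀ + C v * H)) (by
    rw [euler_of_isHomogeneous hφ, verticalDerivation_apply, pderiv_C, mul_zero, zero_add])
  have hstd := isStandard_mul h hH hψ hψE hψD hθ hθE hθD
  have h0 : C e * (C e⁻¹ * (φ₀ + C v * H)) - H * C v = φ₀ := by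
    rw [← mul_assoc, ← C_mul, mul_inv_cancel₀ h.ne_zero, C_1]
    ring
  rw [h0] at hstd
  refine ⟨_, hstd, fun θ' hθ' => ?_⟩
  obtain ⟨h₁, h₂, h₃, h₄⟩ := (isStandard_iff h hH).1 hstd
  obtain ⟨h₁', h₂', h₃', h₄'⟩ := (isStandard_iff h hH).1 hθ'
  exact 𝓐.algEquiv_ext (h₁'.trans h₁.symm) (h₂'.trans h₂.symm) (h₃'.trans h₃.symm)
    (h₄'.trans h₄.symm)

end LineArrangement

namespace LineArrangement

open PlanePoly

variable {k : Type*} [Field k] {r : ℕ} (𝓐 : LineArrangement k r)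

/-! ### Exponentials of polynomials. -/

section Exponentials

theorem map_ad (θ : 𝓐.DiffAlg ≃ₐ[k] 𝓐.DiffAlg) (u t : 𝓐.DiffAlg) :
    θ (𝓐.ad u t) = 𝓐.ad (θ u) (θ t) := by
  simp only [ad_apply, map_sub, map_mul]

theorem map_ad_pow (θ : 𝓐.DiffAlg ≃ₐ[k] 𝓐.DiffAlg) (u t : 𝓐.DiffAlg) (n : ℕ) :
    θ ((𝓐.ad u ^ n) t) = (𝓐.ad (θ u) ^ n) (θ t) := by
  induction n with
  | zero => simp
  | succ n ih => simp only [pow_succ', Module.End.mul_apply, map_ad, ih]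

variable {𝓐} in
theorem IsLocallyAdNilpotent.map {u : 𝓐.DiffAlg} (hu : 𝓐.IsLocallyAdNilpotent u)
    (θ : 𝓐.DiffAlg ≃ₐ[k] 𝓐.DiffAlg) : 𝓐.IsLocallyAdNilpotent (θ u) := by
  intro t
  obtain ⟨n, hn⟩ := hu (θ.symm t)
  exact ⟨n, by rw [← θ.apply_symm_apply t, ← map_ad_pow, hn, map_zero]⟩

variable {𝓐} in
theorem IsLocallyAdNilpotent.map_expAd {u : 𝓐.DiffAlg} (hu : 𝓐.IsLocallyAdNilpotent u)
    (θ : 𝓐.DiffAlg ≃ₐ[k] 𝓐.DiffAlg) (t : 𝓐.DiffAlg) :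
    θ (𝓐.expAd u t) = 𝓐.expAd (θ u) (θ t) := by
  obtain ⟨n, hn⟩ := hu t
  rw [expAd_eq_locExp, expAd_eq_locExp, locExp_eq_sum hn,
    locExp_eq_sum (by rw [← map_ad_pow, hn, map_zero]), map_sum]
  simp only [map_smul, map_ad_pow]

theorem expAd_ofPoly_ofPoly (f g : 𝕊 k) : 𝓐.expAd (𝓐.ofPoly f) (𝓐.ofPoly g) = 𝓐.ofPoly g :=
  locExp_of_apply_eq_zero (𝓐.ad_ofPoly_ofPoly f g)

theorem expAd_ofPoly_E (f : 𝕊 k) :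
    𝓐.expAd (𝓐.ofPoly f) 𝓐.E = 𝓐.E + 𝓐.ofPoly (-eulerDerivation k f) := by
  rw [expAd_eq_locExp, locExp_of_sq, ad_ofPoly_E, map_neg]
  rw [ad_ofPoly_E, map_neg, ad_ofPoly_ofPoly, neg_zero]

theorem expAd_ofPoly_D (f : 𝕊 k) :
    𝓐.expAd (𝓐.ofPoly f) 𝓐.D = 𝓐.D + 𝓐.ofPoly (-𝓐.verticalDerivation f) := by
  rw [expAd_eq_locExp, locExp_of_sq, ad_ofPoly_D, map_neg]
  rw [ad_ofPoly_D, map_neg, ad_ofPoly_ofPoly, neg_zero]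

variable [CharZero k]

/-- The exponential of `ad(f)` as an endomorphism of the algebra. -/
def expHom (f : 𝕊 k) : 𝓐.DiffAlg →ₐ[k] 𝓐.DiffAlg where
  toFun := 𝓐.expAd (𝓐.ofPoly f)
  map_one' := by rw [← map_one 𝓐.ofPoly, expAd_ofPoly_ofPoly]
  map_zero' := by rw [← map_zero 𝓐.ofPoly, expAd_ofPoly_ofPoly]
  map_mul' := locExp_mul (𝓐.ad_mul _) (𝓐.isLocallyAdNilpotent_ofPoly f)
  map_add' := locExp_add (𝓐.isLocallyAdNilpotent_ofPoly f)
  commutes' c := by rw [← ofPoly_C, expAd_ofPoly_ofPoly]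

theorem expHom_ofPoly (f g : 𝕊 k) : 𝓐.expHom f (𝓐.ofPoly g) = 𝓐.ofPoly g :=
  𝓐.expAd_ofPoly_ofPoly f g

theorem expHom_E (f : 𝕊 k) :
    𝓐.expHom f 𝓐.E = 𝓐.E + 𝓐.ofPoly (-eulerDerivation k f) := 𝓐.expAd_ofPoly_E f

theorem expHom_D (f : 𝕊 k) :
    𝓐.expHom f 𝓐.D = 𝓐.D + 𝓐.ofPoly (-𝓐.verticalDerivation f) := 𝓐.expAd_ofPoly_D f

theorem expHom_comp (f g : 𝕊 k) : (𝓐.expHom f).comp (𝓐.expHom g) = 𝓐.expHom (f + g) := by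
  apply 𝓐.algHom_ext
  · simp only [AlgHom.comp_apply, expHom_ofPoly]
  · simp only [AlgHom.comp_apply, expHom_ofPoly]
  · rw [AlgHom.comp_apply, expHom_E, expHom_E, map_add (𝓐.expHom f), expHom_E, expHom_ofPoly,
      add_assoc, ← map_add 𝓐.ofPoly, ← neg_add, ← map_add]
  · rw [AlgHom.comp_apply, expHom_D, expHom_D, map_add (𝓐.expHom f), expHom_D, expHom_ofPoly,
      add_assoc, ← map_add 𝓐.ofPoly, ← neg_add, ← map_add]

theorem expHom_C (c : k) : 𝓐.expHom (C c) = AlgHom.id k 𝓐.DiffAlg := by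
  apply 𝓐.algHom_ext
  · exact 𝓐.expHom_ofPoly _ _
  · exact 𝓐.expHom_ofPoly _ _
  · rw [expHom_E]
    simp
  · rw [expHom_D]
    simp

/-- The exponential of `ad(f)` as an automorphism of the algebra. -/
def expEquiv (f : 𝕊 k) : 𝓐.DiffAlg ≃ₐ[k] 𝓐.DiffAlg :=
  AlgEquiv.ofAlgHom (𝓐.expHom f) (𝓐.expHom (-f))
    (by rw [expHom_comp, add_neg_cancel, ← C_0, expHom_C])
    (by rw [expHom_comp, neg_add_cancel, ← C_0, expHom_C])

theorem expEquiv_apply (f : 𝕊 k) (t : 𝓐.DiffAlg) :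
    𝓐.expEquiv f t = 𝓐.expAd (𝓐.ofPoly f) t := rfl

theorem expEquiv_ofPoly (f g : 𝕊 k) : 𝓐.expEquiv f (𝓐.ofPoly g) = 𝓐.ofPoly g :=
  𝓐.expHom_ofPoly f g

theorem expEquiv_E (f : 𝕊 k) :
    𝓐.expEquiv f 𝓐.E = 𝓐.E + 𝓐.ofPoly (-eulerDerivation k f) := 𝓐.expHom_E f

theorem expEquiv_D (f : 𝕊 k) :
    𝓐.expEquiv f 𝓐.D = 𝓐.D + 𝓐.ofPoly (-𝓐.verticalDerivation f) := 𝓐.expHom_D f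

theorem expEquiv_mul (f g : 𝕊 k) : 𝓐.expEquiv f * 𝓐.expEquiv g = 𝓐.expEquiv (f + g) :=
  AlgEquiv.ext fun t => DFunLike.congr_fun (𝓐.expHom_comp f g) t

theorem expEquiv_C (c : k) : 𝓐.expEquiv (C c) = 1 :=
  AlgEquiv.ext fun t => DFunLike.congr_fun (𝓐.expHom_C c) t

theorem expEquiv_inv (f : 𝕊 k) : (𝓐.expEquiv f)⁻¹ = 𝓐.expEquiv (-f) :=
  inv_eq_of_mul_eq_one_right (by rw [expEquiv_mul, add_neg_cancel, ← C_0, expEquiv_C])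

theorem mem_expAut_iff {θ : 𝓐.DiffAlg ≃ₐ[k] 𝓐.DiffAlg} :
    θ ∈ 𝓐.expAut ↔ ∃ f, 𝓐.expEquiv f = θ := by
  have hE : ∀ f, 𝓐.E - 𝓐.ad 𝓐.E (𝓐.ofPoly f) = 𝓐.expEquiv f 𝓐.E := fun f => by
    rw [expEquiv_E, ad_apply, E_mul_ofPoly, map_neg]
    abel
  have hD : ∀ f, 𝓐.D - 𝓐.ofPoly (𝓐.F * pderiv 1 f) = 𝓐.expEquiv f 𝓐.D := fun f => by
    rw [expEquiv_D, map_neg, sub_eq_add_neg]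
    rfl
  constructor
  · rintro ⟨f, h₀, h₁, h₂, h₃⟩
    refine ⟨f, 𝓐.algEquiv_ext ?_ ?_ ?_ ?_⟩
    · rw [h₀, expEquiv_ofPoly]
    · rw [h₁, expEquiv_ofPoly]
    · rw [h₃, hE]
    · rw [h₂, hD]
  · rintro ⟨f, rfl⟩
    exact ⟨f, 𝓐.expEquiv_ofPoly f _, 𝓐.expEquiv_ofPoly f _, (hD f).symm, (hE f).symm⟩

/-- Automorphisms transport the exponential series. This yields both the normality of the
exponentials and the formula for the action. -/
theorem conj_expEquiv {θ : 𝓐.DiffAlg ≃ₐ[k] 𝓐.DiffAlg} {f g : 𝕊 k}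
    (h : θ (𝓐.ofPoly f) = 𝓐.ofPoly g) : θ * 𝓐.expEquiv f * θ⁻¹ = 𝓐.expEquiv g := by
  rw [mul_inv_eq_iff_eq_mul]
  refine AlgEquiv.ext fun t => ?_
  rw [AlgEquiv.mul_apply, AlgEquiv.mul_apply, expEquiv_apply, expEquiv_apply,
    (𝓐.isLocallyAdNilpotent_ofPoly f).map_expAd, h]

theorem image_expAut :
    (fun θ : 𝓐.DiffAlg ≃ₐ[k] 𝓐.DiffAlg => (θ : 𝓐.DiffAlg → 𝓐.DiffAlg)) '' 𝓐.expAut =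
      {φ | ∃ f : 𝕊 k, φ = 𝓐.expAd (𝓐.ofPoly f)} := by
  ext φ
  constructor
  · rintro ⟨θ, hθ, rfl⟩
    obtain ⟨f, rfl⟩ := 𝓐.mem_expAut_iff.1 hθ
    exact ⟨f, rfl⟩
  · rintro ⟨f, rfl⟩
    exact ⟨𝓐.expEquiv f, 𝓐.mem_expAut_iff.2 ⟨f, rfl⟩, rfl⟩

theorem image_expAut' :
    (fun θ : 𝓐.DiffAlg ≃ₐ[k] 𝓐.DiffAlg => (θ : 𝓐.DiffAlg → 𝓐.DiffAlg)) '' 𝓐.expAut =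
      {φ | ∃ u : 𝓐.DiffAlg, 𝓐.IsLocallyAdNilpotent u ∧ φ = 𝓐.expAd u} := by
  rw [image_expAut]
  ext φ
  constructor
  · rintro ⟨f, rfl⟩
    exact ⟨_, 𝓐.isLocallyAdNilpotent_ofPoly f, rfl⟩
  · rintro ⟨u, hu, rfl⟩
    obtain ⟨f, rfl⟩ := 𝓐.exists_eq_ofPoly_of_isLocallyAdNilpotent hu
    exact ⟨f, rfl⟩

end Exponentials

/-! ### Decomposition of an arbitrary automorphism. -/

section Classification

variable {𝓐} in
theorem IsNormalElement.map {p : 𝓐.DiffAlg} (hp : 𝓐.IsNormalElement p)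
    (θ : 𝓐.DiffAlg ≃ₐ[k] 𝓐.DiffAlg) : 𝓐.IsNormalElement (θ p) := by
  intro t
  obtain ⟨s, hs⟩ := hp (θ.symm t)
  exact ⟨θ s, by rw [← map_mul, ← hs, map_mul, AlgEquiv.apply_symm_apply]⟩

/-- The automorphisms that fix `S` add polynomials to `E` and `D`. -/
theorem exists_eq_of_fix {ψ : 𝓐.DiffAlg ≃ₐ[k] 𝓐.DiffAlg}
    (hψ : ∀ f, ψ (𝓐.ofPoly f) = 𝓐.ofPoly f) :
    ∃ ε φ : 𝕊 k, ψ 𝓐.E = 𝓐.E + 𝓐.ofPoly ε ∧ ψ 𝓐.D = 𝓐.D + 𝓐.ofPoly φ ∧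
      eulerDerivation k φ = 𝓐.verticalDerivation ε + (r : 𝕊 k) * φ := by
  have key : ∀ (T : 𝓐.DiffAlg) (δ : Derivation k (𝕊 k) (𝕊 k)),
      (∀ f, T * 𝓐.ofPoly f = 𝓐.ofPoly f * T + 𝓐.ofPoly (δ f)) →
      ∃ g, ψ T = T + 𝓐.ofPoly g := by
    intro T δ hT
    -- $T$ and $\psi(T)$ have the same commutators with $S$, so their difference commutes with $S$
    -- and is a polynomial.
    refine ⟨𝓐.toEnd (ψ T - T) 1, ?_⟩
    rw [← 𝓐.eq_ofPoly_of_commute, add_sub_cancel]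
    intro i
    have h := congrArg ψ (hT (X i))
    simp only [map_mul, map_add, hψ] at h
    rw [sub_mul, mul_sub, h, hT]
    abel
  obtain ⟨ε, hε⟩ := key _ _ 𝓐.E_mul_ofPoly
  obtain ⟨φ, hφ⟩ := key _ _ 𝓐.D_mul_ofPoly
  refine ⟨ε, φ, hε, hφ, 𝓐.ofPoly_injective ?_⟩
  have hr : (r : 𝓐.DiffAlg) = 𝓐.ofPoly (r : 𝕊 k) := by simp
  have hcomm : 𝓐.ofPoly φ * 𝓐.ofPoly ε = 𝓐.ofPoly ε * 𝓐.ofPoly φ := by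
    rw [← map_mul, ← map_mul, mul_comm]
  have h := congrArg ψ 𝓐.E_mul_D
  rw [hr, map_mul, map_add, map_mul, map_mul, hψ, hε, hφ, add_mul, mul_add, mul_add, E_mul_D,
    E_mul_ofPoly, mul_add, add_mul, add_mul, mul_add, D_mul_ofPoly, hcomm, ← hr] at h
  rw [map_add, map_mul, map_natCast]
  rw [← sub_eq_zero] at h ⊢
  rw [← h]
  abel

variable [CharZero k]

theorem exists_map_ofPoly (θ : 𝓐.DiffAlg ≃ₐ[k] 𝓐.DiffAlg) (f : 𝕊 k) :
    ∃ g, θ (𝓐.ofPoly f) = 𝓐.ofPoly g :=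
  𝓐.exists_eq_ofPoly_of_isLocallyAdNilpotent ((𝓐.isLocallyAdNilpotent_ofPoly f).map θ)

/-- Every automorphism of the algebra restricts to an automorphism of `S`. -/
theorem exists_restrict (θ : 𝓐.DiffAlg ≃ₐ[k] 𝓐.DiffAlg) :
    ∃ σ : 𝕊 k ≃ₐ[k] 𝕊 k, ∀ f, θ (𝓐.ofPoly f) = 𝓐.ofPoly (σ f) := by
  choose s hs using 𝓐.exists_map_ofPoly θ
  choose s' hs' using 𝓐.exists_map_ofPoly θ.symm
  refine ⟨{ toFun := s, invFun := s', left_inv := fun f => ?_, right_inv := fun f => ?_,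
            map_mul' := fun f g => ?_, map_add' := fun f g => ?_, commutes' := fun c => ?_ }, hs⟩
  all_goals apply 𝓐.ofPoly_injective
  · rw [← hs', ← hs, AlgEquiv.symm_apply_apply]
  · rw [← hs, ← hs', AlgEquiv.apply_symm_apply]
  · rw [← hs, map_mul, map_mul, map_mul, hs, hs]
  · rw [← hs, map_add, map_add, map_add, hs, hs]
  · rw [← hs, AlgHom.commutes, AlgEquiv.commutes]

theorem image_range_ofPoly (θ : 𝓐.DiffAlg ≃ₐ[k] 𝓐.DiffAlg) :
    (fun t => θ t) '' Set.range 𝓐.ofPoly = Set.range 𝓐.ofPoly := by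
  obtain ⟨σ, hσ⟩ := 𝓐.exists_restrict θ
  ext t
  constructor
  · rintro ⟨-, ⟨f, rfl⟩, rfl⟩
    exact ⟨σ f, (hσ f).symm⟩
  · rintro ⟨f, rfl⟩
    exact ⟨_, ⟨σ.symm f, rfl⟩, (hσ _).trans (by rw [AlgEquiv.apply_symm_apply])⟩

theorem restrict_irreducible_dvd_Q {θ : 𝓐.DiffAlg ≃ₐ[k] 𝓐.DiffAlg} {σ : 𝕊 k ≃ₐ[k] 𝕊 k}
    (hσ : ∀ f, θ (𝓐.ofPoly f) = 𝓐.ofPoly (σ f)) {p : 𝕊 k} (hp : Irreducible p) (h : p ∣ 𝓐.Q) :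
    Irreducible (σ p) ∧ σ p ∣ 𝓐.Q := by
  have hirr : Irreducible (σ p) := (MulEquiv.irreducible_iff σ).2 hp
  refine ⟨hirr, 𝓐.irreducible_dvd_Q_of_isNormalElement hirr ?_⟩
  rw [← hσ]
  exact (𝓐.isNormalElement_of_irreducible_of_dvd_Q hp h).map θ

/-- Each irreducible factor $p$ of $Q$ is $\sigma$ of the factor $\sigma^{-1}(p)$, and $Q$ is
square-free. -/
theorem Q_dvd_restrict_Q {θ : 𝓐.DiffAlg ≃ₐ[k] 𝓐.DiffAlg} {σ : 𝕊 k ≃ₐ[k] 𝕊 k}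
    (hσ : ∀ f, θ (𝓐.ofPoly f) = 𝓐.ofPoly (σ f)) : 𝓐.Q ∣ σ 𝓐.Q := by
  have hσ' : ∀ f, θ.symm (𝓐.ofPoly f) = 𝓐.ofPoly (σ.symm f) := fun f => by
    rw [AlgEquiv.symm_apply_eq, hσ, AlgEquiv.apply_symm_apply]
  refine dvd_of_squarefree_of_irreducible_dvd 𝓐.Q_squarefree fun p hp hpQ => ?_
  have h := map_dvd σ (𝓐.restrict_irreducible_dvd_Q hσ' hp hpQ).2
  rwa [AlgEquiv.apply_symm_apply] at h

/-- Every automorphism of the algebra acts on `S` by a linear substitution that preserves the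
arrangement. -/
theorem exists_preservesQ (θ : 𝓐.DiffAlg ≃ₐ[k] 𝓐.DiffAlg) :
    ∃ a b c d e : k, 𝓐.PreservesQ a b c d e ∧
      ∀ f, θ (𝓐.ofPoly f) = 𝓐.ofPoly (subst a b c d f) := by
  obtain ⟨σ, hσ⟩ := 𝓐.exists_restrict θ
  have hσ' : ∀ f, θ.symm (𝓐.ofPoly f) = 𝓐.ofPoly (σ.symm f) := fun f => by
    rw [AlgEquiv.symm_apply_eq, hσ, AlgEquiv.apply_symm_apply]
  obtain ⟨p, hp, hpF⟩ := 𝓐.exists_irreducible_dvd_F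
  obtain ⟨a₀, b₀, hb₀, hab⟩ := 𝓐.exists_eq_of_dvd_F hp hpF
  obtain ⟨hi, hd⟩ := 𝓐.restrict_irreducible_dvd_Q hσ X_prime.irreducible 𝓐.X_dvd_Q
  obtain ⟨a, b, hx⟩ := 𝓐.exists_eq_of_dvd_Q hi hd
  obtain ⟨hi', hd'⟩ := 𝓐.restrict_irreducible_dvd_Q hσ hp (hpF.trans 𝓐.F_dvd_Q)
  obtain ⟨a', b', hp'⟩ := 𝓐.exists_eq_of_dvd_Q hi' hd'
  have hσC : ∀ s, σ (C s) = C s := fun s => σ.commutes s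
  obtain ⟨c, d, hy⟩ : ∃ c d : k, σ (X 1) = C c * X 0 + C d * X 1 := by
    -- Solves $a_0\sigma(x)+b_0\sigma(y)=a'x+b'y$ for $\sigma(y)$.
    refine ⟨b₀⁻¹ * (a' - a₀ * a), b₀⁻¹ * (b' - a₀ * b), ?_⟩
    rw [hab, map_add, map_mul, map_mul, hσC, hσC, hx] at hp'
    have hC : (C b₀⁻¹ * C b₀ : 𝕊 k) = 1 := by rw [← C_mul, inv_mul_cancel₀ hb₀, C_1]
    simp only [C_mul, C_sub]
    linear_combination C b₀⁻¹ * hp' - σ (X 1) * hC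
  have hsub : ∀ f, σ f = subst a b c d f := by
    have h : (σ : 𝕊 k →ₐ[k] 𝕊 k) = subst a b c d :=
      algHom_ext₂ (by simpa using hx) (by simpa using hy)
    exact fun f => DFunLike.congr_fun h f
  have hdet : a * d - b * c ≠ 0 := by
    intro hdet
    have hlin : ∀ u w : k, σ (C u * X 0 + C w * X 1) = 0 → u = 0 ∧ w = 0 := fun u w h => by
      have h0 : (C u * X 0 + C w * X 1 : 𝕊 k) = 0 := (map_eq_zero_iff σ σ.injective).1 h
      constructor
      · simpa [pderiv_X] using congrArg (pderiv 0) h0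
      · simpa [pderiv_X] using congrArg (pderiv 1) h0
    have hdet' : (C a * C d - C b * C c : 𝕊 k) = 0 := by rw [← C_mul, ← C_mul, ← C_sub, hdet, C_0]
    -- If the determinant vanishes, $\sigma$ kills $dx-by$ and $cx-ay$; injectivity then gives
    -- $a=b=0$ and $\sigma(x)=0$.
    obtain ⟨-, hb⟩ := hlin d (-b) (by
      rw [map_add, map_mul, map_mul, hσC, hσC, hx, hy, C_neg]
      linear_combination X 0 * hdet')
    obtain ⟨-, ha⟩ := hlin c (-a) (by
      rw [map_add, map_mul, map_mul, hσC, hσC, hx, hy, C_neg]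
      linear_combination -X 1 * hdet')
    refine hi.ne_zero ?_
    rw [hx, neg_eq_zero.1 hb, neg_eq_zero.1 ha]
    simp
  have hdvd : σ 𝓐.Q ∣ 𝓐.Q := by
    have h := map_dvd σ (𝓐.Q_dvd_restrict_Q hσ')
    rwa [AlgEquiv.apply_symm_apply] at h
  obtain ⟨u, hu⟩ := associated_of_dvd_dvd (𝓐.Q_dvd_restrict_Q hσ) hdvd
  obtain ⟨s, hs, hsu⟩ := (isUnit_iff_eq_C_of_isReduced).1 u.isUnit
  -- $\sigma(Q)=sQ$, so $e$ is determined by $(ad-bc)e=s$.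
  refine ⟨a, b, c, d, s / (a * d - b * c), ?_, fun f => by rw [hσ, hsub]⟩
  rw [preservesQ_iff]
  refine ⟨hdet, div_ne_zero hs.ne_zero hdet, ?_⟩
  rw [mul_div_cancel₀ _ hdet, ← hsub, ← hu, hsu, mul_comm]

theorem exists_eq_mul_conj (θ : 𝓐.DiffAlg ≃ₐ[k] 𝓐.DiffAlg) :
    ∃ (a b c d e : k) (H : 𝕊 k) (ψ χ : 𝓐.DiffAlg ≃ₐ[k] 𝓐.DiffAlg),
      𝓐.PreservesQ a b c d e ∧ H * (C a * X 0 + C b * X 1) = C (e * b) * 𝓐.F ∧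
      (∀ f, χ (𝓐.ofPoly f) = 𝓐.ofPoly (subst a b c d f)) ∧ χ 𝓐.E = 𝓐.E ∧
      χ 𝓐.D = e • 𝓐.D - 𝓐.ofPoly H * 𝓐.E ∧ (∀ f, ψ (𝓐.ofPoly f) = 𝓐.ofPoly f) ∧ θ = ψ * χ := by
  obtain ⟨a, b, c, d, e, h, hθ⟩ := 𝓐.exists_preservesQ θ
  obtain ⟨H, hH⟩ := h.exists_coeff
  obtain ⟨χ, hχ, hχE, hχD⟩ := h.exists_conj hH
  refine ⟨a, b, c, d, e, H, θ * χ⁻¹, χ, h, hH, hχ, hχE, hχD, fun f => ?_,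
    (inv_mul_cancel_right θ χ).symm⟩
  obtain ⟨g, rfl⟩ := (substEquiv a b c d h.det_ne_zero).surjective f
  rw [substEquiv_apply, ← hχ, AlgEquiv.mul_apply, AlgEquiv.aut_inv, AlgEquiv.symm_apply_apply,
    hθ, hχ]

variable {𝓐} in
-- For constant $\varepsilon$ the relation of `exists_eq_of_fix` reads $E(\varphi)=r\varphi$, so
-- $\varphi\in S_r$ comes for free.
theorem mul_mem_aut₀ {a b c d e : k} {H : 𝕊 k} {ψ χ : 𝓐.DiffAlg ≃ₐ[k] 𝓐.DiffAlg}
    (h : 𝓐.PreservesQ a b c d e) (hH : H * (C a * X 0 + C b * X 1) = C (e * b) * 𝓐.F)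
    (hχ : ∀ f, χ (𝓐.ofPoly f) = 𝓐.ofPoly (subst a b c d f)) (hχE : χ 𝓐.E = 𝓐.E)
    (hχD : χ 𝓐.D = e • 𝓐.D - 𝓐.ofPoly H * 𝓐.E) (hψ : ∀ f, ψ (𝓐.ofPoly f) = 𝓐.ofPoly f)
    {v : k} (hψE : ψ 𝓐.E = 𝓐.E + 𝓐.ofPoly (C v)) : ψ * χ ∈ 𝓐.aut₀ := by
  obtain ⟨ε, φ, hε, hφ, hεφ⟩ := 𝓐.exists_eq_of_fix hψ
  have hv : ε = C v := 𝓐.ofPoly_injective (add_left_cancel (hε.symm.trans hψE))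
  have hφr : φ.IsHomogeneous r := by
    refine isHomogeneous_of_euler ?_
    rw [hεφ, hv, verticalDerivation_apply, pderiv_C, mul_zero, zero_add]
  refine ⟨a, b, c, d, e, v, _, h, ?_, isStandard_mul h hH hψ hψE hφ hχ hχE hχD⟩
  refine (hφr.C_mul e).sub ?_
  rw [mul_comm]
  exact (isHomogeneous_coeff h hH).C_mul v

theorem mem_aut₀_iff {θ : 𝓐.DiffAlg ≃ₐ[k] 𝓐.DiffAlg} :
    θ ∈ 𝓐.aut₀ ↔ ∃ v : k, θ 𝓐.E = 𝓐.E + algebraMap k 𝓐.DiffAlg v := by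
  constructor
  · rintro ⟨a, b, c, d, e, v, φ₀, -, -, h⟩
    exact ⟨v, h.map_E⟩
  · rintro ⟨v, hv⟩
    obtain ⟨a, b, c, d, e, H, ψ, χ, h, hH, hχ, hχE, hχD, hψ, rfl⟩ := 𝓐.exists_eq_mul_conj θ
    rw [AlgEquiv.mul_apply, hχE, ← ofPoly_C] at hv
    exact mul_mem_aut₀ h hH hχ hχE hχD hψ hv

/-- The homogeneous components of the algebra are the eigenspaces of `ad(E)`. -/
theorem mem_gradedPiece_iff {n : ℕ} {t : 𝓐.DiffAlg} :
    t ∈ 𝓐.gradedPiece n ↔ 𝓐.E * t = t * 𝓐.E + (n : 𝓐.DiffAlg) * t := by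
  have hn : (n : 𝓐.DiffAlg) = 𝓐.ofPoly (n : 𝕊 k) := by simp
  have hmul : ∀ (p : ℕ) (f : 𝕊 k), 𝓐.toEnd t ((p : 𝕊 k) * f) = (p : 𝕊 k) * 𝓐.toEnd t f := by
    intro p f
    rw [← nsmul_eq_mul, map_nsmul, nsmul_eq_mul]
  rw [hn]
  constructor
  · intro ht
    refine 𝓐.toEnd_ext fun f => ?_
    rw [← sum_homogeneousComponent f]
    simp only [map_sum]
    refine Finset.sum_congr rfl fun p _ => ?_
    have hp := homogeneousComponent_isHomogeneous p f
    simp only [map_mul, map_add, Module.End.mul_apply, LinearMap.add_apply, toEnd_E, toEnd_ofPoly]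
    rw [euler_of_isHomogeneous (ht p _ hp), euler_of_isHomogeneous hp, hmul]
    push_cast
    ring
  · intro h p f hf
    refine isHomogeneous_of_euler ?_
    have h' := congrArg (fun t => 𝓐.toEnd t f) h
    simp only [map_mul, map_add, Module.End.mul_apply, LinearMap.add_apply, toEnd_E,
      toEnd_ofPoly] at h'
    rw [h', euler_of_isHomogeneous hf, hmul]
    push_cast
    ring

theorem mem_aut₀_iff_gradedPiece (θ : 𝓐.DiffAlg ≃ₐ[k] 𝓐.DiffAlg) :
    θ ∈ 𝓐.aut₀ ↔ ∀ (n : ℕ), ∀ t ∈ 𝓐.gradedPiece n, θ t ∈ 𝓐.gradedPiece n := by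
  constructor
  · rw [mem_aut₀_iff]
    rintro ⟨v, hv⟩ n t ht
    rw [mem_gradedPiece_iff] at ht ⊢
    have h := congrArg θ ht
    rw [map_mul, map_add, map_mul, map_mul, hv, add_mul, mul_add, Algebra.commutes v (θ t),
      map_natCast, add_right_comm] at h
    exact add_right_cancel h
  · intro h
    obtain ⟨a, b, c, d, e, H, ψ, χ, hQ, hH, hχ, hχE, hχD, hψ, rfl⟩ := 𝓐.exists_eq_mul_conj θ
    obtain ⟨ε, φ, hε, -, -⟩ := 𝓐.exists_eq_of_fix hψ
    -- $E$ has degree $0$, so its image $E+\varepsilon$ commutes with $E$. Thus $E(\varepsilon)=0$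
    -- and $\varepsilon$ is constant.
    have h0 := h 0 𝓐.E (𝓐.mem_gradedPiece_iff.2 (by simp))
    rw [AlgEquiv.mul_apply, hχE, hε, mem_gradedPiece_iff, mul_add, add_mul, E_mul_ofPoly,
      Nat.cast_zero, zero_mul, add_zero] at h0
    have h1 := add_left_cancel h0
    rw [add_eq_left, map_eq_zero_iff _ 𝓐.ofPoly_injective] at h1
    have h2 : ε.IsHomogeneous 0 := isHomogeneous_of_euler (by rw [h1]; simp)
    rw [totalDegree_eq_zero_iff_eq_C.1 (Nat.le_zero.1 h2.totalDegree_le)] at hε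
    exact mul_mem_aut₀ hQ hH hχ hχE hχD hψ hε

theorem exists_eq_expEquiv_mul (θ : 𝓐.DiffAlg ≃ₐ[k] 𝓐.DiffAlg) :
    ∃ f, ∃ θ₀ ∈ 𝓐.aut₀, θ = 𝓐.expEquiv f * θ₀ := by
  obtain ⟨a, b, c, d, e, H, ψ, χ, -, -, -, hχE, -, hψ, rfl⟩ := 𝓐.exists_eq_mul_conj θ
  obtain ⟨ε, φ, hε, -, -⟩ := 𝓐.exists_eq_of_fix hψ
  obtain ⟨v, f, hvf⟩ := exists_eq_const_sub_euler ε
  refine ⟨f, (𝓐.expEquiv f)⁻¹ * (ψ * χ), 𝓐.mem_aut₀_iff.2 ⟨v, ?_⟩, (mul_inv_cancel_left _ _).symm⟩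
  rw [AlgEquiv.mul_apply, AlgEquiv.mul_apply, hχE, hε, expEquiv_inv, map_add, expEquiv_ofPoly,
    expEquiv_E, hvf, map_neg (eulerDerivation k), neg_neg, add_assoc, ← map_add,
    add_sub_cancel, ofPoly_C]

/-- $\exp\operatorname{ad}(f)$ moves $E$ by $-E(f)$, which has no constant term. If it is a
constant, it is zero; then $f$ is constant and its exponential trivial. -/
theorem eq_one_of_mem_aut₀_of_mem_expAut {θ : 𝓐.DiffAlg ≃ₐ[k] 𝓐.DiffAlg} (h₀ : θ ∈ 𝓐.aut₀)
    (h₁ : θ ∈ 𝓐.expAut) : θ = 1 := by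
  obtain ⟨f, rfl⟩ := 𝓐.mem_expAut_iff.1 h₁
  obtain ⟨v, hv⟩ := 𝓐.mem_aut₀_iff.1 h₀
  rw [expEquiv_E, ← ofPoly_C] at hv
  have h := 𝓐.ofPoly_injective (add_left_cancel hv)
  have hv0 : (C v : 𝕊 k) = 0 := by
    have h' := homogeneousComponent_euler 0 f
    rwa [neg_eq_iff_eq_neg.1 h, map_neg, homogeneousComponent_of_mem (isHomogeneous_C _ v),
      if_pos rfl, Nat.cast_zero, zero_mul, neg_eq_zero] at h'
  rw [hv0, neg_eq_zero] at h
  have h2 : f.IsHomogeneous 0 := isHomogeneous_of_euler (by rw [h]; simp)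
  rw [totalDegree_eq_zero_iff_eq_C.1 (Nat.le_zero.1 h2.totalDegree_le), expEquiv_C]

end Classification

/-! ### The two subgroups and the semidirect product. -/

section Subgroups

variable [CharZero k]

/-- The subgroup of the automorphisms that preserve the grading. -/
def autSubgroup : Subgroup (𝓐.DiffAlg ≃ₐ[k] 𝓐.DiffAlg) where
  carrier := 𝓐.aut₀
  one_mem' := 𝓐.mem_aut₀_iff.2 ⟨0, by simp⟩
  mul_mem' {θ θ'} h h' := by
    rw [mem_aut₀_iff] at h h' ⊢
    obtain ⟨v, hv⟩ := h
    obtain ⟨w, hw⟩ := h'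
    exact ⟨v + w, by rw [AlgEquiv.mul_apply, hw, map_add, hv, AlgEquiv.commutes, map_add,
      add_assoc]⟩
  inv_mem' {θ} h := by
    rw [mem_aut₀_iff] at h ⊢
    obtain ⟨v, hv⟩ := h
    refine ⟨-v, ?_⟩
    rw [AlgEquiv.aut_inv, AlgEquiv.symm_apply_eq, map_add, hv, AlgEquiv.commutes, map_neg,
      add_neg_cancel_right]

/-- The subgroup of the exponentials of polynomials. -/
def expSubgroup : Subgroup (𝓐.DiffAlg ≃ₐ[k] 𝓐.DiffAlg) where
  carrier := 𝓐.expAut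
  one_mem' := 𝓐.mem_expAut_iff.2 ⟨C 0, 𝓐.expEquiv_C 0⟩
  mul_mem' {θ θ'} h h' := by
    obtain ⟨f, rfl⟩ := 𝓐.mem_expAut_iff.1 h
    obtain ⟨g, rfl⟩ := 𝓐.mem_expAut_iff.1 h'
    exact 𝓐.mem_expAut_iff.2 ⟨f + g, (𝓐.expEquiv_mul f g).symm⟩
  inv_mem' {θ} h := by
    obtain ⟨f, rfl⟩ := 𝓐.mem_expAut_iff.1 h
    exact 𝓐.mem_expAut_iff.2 ⟨-f, (𝓐.expEquiv_inv f).symm⟩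

instance : 𝓐.expSubgroup.Normal where
  conj_mem η hη θ := by
    obtain ⟨f, rfl⟩ := 𝓐.mem_expAut_iff.1 hη
    obtain ⟨g, hg⟩ := 𝓐.exists_map_ofPoly θ f
    exact 𝓐.mem_expAut_iff.2 ⟨g, (𝓐.conj_expEquiv hg).symm⟩

theorem isComplement'_aut_exp : 𝓐.autSubgroup.IsComplement' 𝓐.expSubgroup := by
  refine Subgroup.isComplement'_of_disjoint_and_mul_eq_univ ?_ ?_
  · rw [Subgroup.disjoint_def]
    exact fun h₀ h₁ => 𝓐.eq_one_of_mem_aut₀_of_mem_expAut h₀ h₁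
  · refine Set.eq_univ_of_forall fun θ => ?_
    obtain ⟨f, θ₀, h₀, rfl⟩ := 𝓐.exists_eq_expEquiv_mul θ
    -- Normality moves the exponential to the right of $\theta_0$.
    refine ⟨θ₀, h₀, θ₀⁻¹ * 𝓐.expEquiv f * θ₀, ?_, ?_⟩
    · have h := (inferInstance : 𝓐.expSubgroup.Normal).conj_mem (𝓐.expEquiv f)
        (𝓐.mem_expAut_iff.2 ⟨f, rfl⟩) θ₀⁻¹
      rwa [inv_inv] at h
    · simp only [mul_assoc, mul_inv_cancel_left]

end Subgroups

end LineArrangement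

end

theorem mainTheorem8 {k : Type*} [Field k] [CharZero k] {r : ℕ} (𝓐 : LineArrangement k r) :
    -- every admissible datum determines exactly one explicit automorphism
    (∀ (a b c d e v : k) (φ₀ : MvPolynomial (Fin 2) k),
      𝓐.PreservesQ a b c d e → φ₀.IsHomogeneous r →
        ∃! θ : 𝓐.DiffAlg ≃ₐ[k] 𝓐.DiffAlg, 𝓐.IsStandard a b c d e v φ₀ θ) ∧
    -- the elements of `S` are locally ad-nilpotent
    (∀ f : MvPolynomial (Fin 2) k, 𝓐.IsLocallyAdNilpotent (𝓐.ofPoly f)) ∧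
    -- `Exp` is the set of all `exp ad(f)` with `f` in `S`, and also the set of the exponentials
    -- of all locally nilpotent inner derivations
    (fun θ : 𝓐.DiffAlg ≃ₐ[k] 𝓐.DiffAlg => (θ : 𝓐.DiffAlg → 𝓐.DiffAlg)) '' 𝓐.expAut =
      {φ | ∃ f : MvPolynomial (Fin 2) k, φ = 𝓐.expAd (𝓐.ofPoly f)} ∧
    (fun θ : 𝓐.DiffAlg ≃ₐ[k] 𝓐.DiffAlg => (θ : 𝓐.DiffAlg → 𝓐.DiffAlg)) '' 𝓐.expAut =
      {φ | ∃ u : 𝓐.DiffAlg, 𝓐.IsLocallyAdNilpotent u ∧ φ = 𝓐.expAd u} ∧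
    -- `Aut₀` is the set of automorphisms that preserve the grading
    (∀ θ : 𝓐.DiffAlg ≃ₐ[k] 𝓐.DiffAlg,
      θ ∈ 𝓐.aut₀ ↔ ∀ (n : ℕ), ∀ t ∈ 𝓐.gradedPiece n, θ t ∈ 𝓐.gradedPiece n) ∧
    -- the elements of `Aut₀` map `S` onto `S`
    (∀ θ ∈ 𝓐.aut₀, (fun t => θ t) '' Set.range 𝓐.ofPoly = Set.range 𝓐.ofPoly) ∧
    -- `Aut₀` and `Exp` are subgroups, and the automorphism group is their semidirect product
    ∃ G₀ N : Subgroup (𝓐.DiffAlg ≃ₐ[k] 𝓐.DiffAlg),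
      (G₀ : Set (𝓐.DiffAlg ≃ₐ[k] 𝓐.DiffAlg)) = 𝓐.aut₀ ∧
      (N : Set (𝓐.DiffAlg ≃ₐ[k] 𝓐.DiffAlg)) = 𝓐.expAut ∧
      N.Normal ∧
      Function.Bijective (fun p : G₀ × N =>
        (p.1 : 𝓐.DiffAlg ≃ₐ[k] 𝓐.DiffAlg) * (p.2 : 𝓐.DiffAlg ≃ₐ[k] 𝓐.DiffAlg)) ∧
      -- the right action `θ₀ · exp ad(f) = exp ad(θ₀⁻¹(f))` of `Aut₀` on the group `Exp`
      ∃ act : G₀ᵐᵒᵖ →* MulAut N,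
        (∀ (θ₀ : G₀) (f : MvPolynomial (Fin 2) k) (η : N),
          (∀ t, (η : 𝓐.DiffAlg ≃ₐ[k] 𝓐.DiffAlg) t = 𝓐.expAd (𝓐.ofPoly f) t) →
          ∀ t, (act (MulOpposite.op θ₀) η : 𝓐.DiffAlg ≃ₐ[k] 𝓐.DiffAlg) t =
            𝓐.expAd ((θ₀ : 𝓐.DiffAlg ≃ₐ[k] 𝓐.DiffAlg).symm (𝓐.ofPoly f)) t) ∧
        -- the product of `Aut₀ ⋉ Exp`
        (∀ (θ₀ θ₁ : G₀) (η₀ η₁ : N),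
          ((θ₀ : 𝓐.DiffAlg ≃ₐ[k] 𝓐.DiffAlg) * η₀) * ((θ₁ : 𝓐.DiffAlg ≃ₐ[k] 𝓐.DiffAlg) * η₁) =
            ((θ₀ * θ₁ : G₀) : 𝓐.DiffAlg ≃ₐ[k] 𝓐.DiffAlg) *
              ((act (MulOpposite.op θ₁) η₀ * η₁ : N) : 𝓐.DiffAlg ≃ₐ[k] 𝓐.DiffAlg)) ∧
        ∃ Φ : (N ⋊[act.comp (MulEquiv.inv' G₀).toMonoidHom] G₀) ≃* (𝓐.DiffAlg ≃ₐ[k] 𝓐.DiffAlg),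
          ∀ (η : N) (θ₀ : G₀), Φ ⟨η, θ₀⟩ =
            (η : 𝓐.DiffAlg ≃ₐ[k] 𝓐.DiffAlg) * (θ₀ : 𝓐.DiffAlg ≃ₐ[k] 𝓐.DiffAlg) := by
  refine ⟨fun a b c d e v φ₀ h hφ₀ => h.existsUnique_isStandard v hφ₀,
    𝓐.isLocallyAdNilpotent_ofPoly, 𝓐.image_expAut, 𝓐.image_expAut', 𝓐.mem_aut₀_iff_gradedPiece,
    fun θ _ => 𝓐.image_range_ofPoly θ, 𝓐.autSubgroup, 𝓐.expSubgroup, rfl, rfl, inferInstance,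
    𝓐.isComplement'_aut_exp, (MulAut.conjNormal.comp 𝓐.autSubgroup.subtype).comp
      (MulEquiv.inv' 𝓐.autSubgroup).symm.toMonoidHom, fun θ₀ f η hη t => ?_,
    fun θ₀ θ₁ η₀ η₁ => ?_, ?_⟩
  · obtain ⟨g, hg⟩ := 𝓐.exists_map_ofPoly (θ₀⁻¹ : 𝓐.DiffAlg ≃ₐ[k] 𝓐.DiffAlg) f
    have hη' : (η : 𝓐.DiffAlg ≃ₐ[k] 𝓐.DiffAlg) = 𝓐.expEquiv f := AlgEquiv.ext hη
    have hconj := 𝓐.conj_expEquiv hg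
    rw [← hη'] at hconj
    rw [AlgEquiv.aut_inv] at hg
    rw [hg, ← LineArrangement.expEquiv_apply, ← hconj]
    rfl
  · have h : ((((MulAut.conjNormal.comp 𝓐.autSubgroup.subtype).comp
        (MulEquiv.inv' 𝓐.autSubgroup).symm.toMonoidHom) (MulOpposite.op θ₁) η₀ :
          𝓐.expSubgroup) : 𝓐.DiffAlg ≃ₐ[k] 𝓐.DiffAlg) =
        (θ₁ : 𝓐.DiffAlg ≃ₐ[k] 𝓐.DiffAlg)⁻¹ * η₀ * θ₁ := rfl
    rw [Subgroup.coe_mul, Subgroup.coe_mul, h]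
    group
  · refine ⟨MulEquiv.ofBijective (SemidirectProduct.lift 𝓐.expSubgroup.subtype
      𝓐.autSubgroup.subtype fun θ => ?_) ?_, fun η θ₀ => rfl⟩
    · exact MonoidHom.ext fun η => rfl
    · exact 𝓐.isComplement'_aut_exp.symm.comp (SemidirectProduct.equivProd).bijective
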